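/- Let $\xi=\{\xi(k)\}_{k\in\mathbb Z}$ be i.i.d. non-negative random variables with $\lambda_1=\mathbb E[\xi(0)]\in(0,\infty)$ and $\sigma^2=\mathrm{Var}[\xi(0)]\in(0,\infty)$, let $a>0$, and let $b=\{b(j)\}_{j\ge1}$ be non-negative and not identically zero. Let $X=\{X(k)\}_{k\in\mathbb Z}$ be a weakly stationary solution of the ARCH($\infty$) equations $$X(k)=\varsigma(k)\,\xi(k),\qquad \varsigma(k)=a+\sum_{j=1}^\infty b(j)X(k-j),\qquad k\in\mathbb Z,$$ let $\rho(k)=\mathrm{Cov}[X(n),X(n+k)]$ be its autocovariance function, and put $\nu(k)=X(k)-\lambda_1\varsigma(k)$. For $r>0$ let $\mathcal W(r)$ be the class of sequences $\gamma=\{\gamma(n)\}_{n\ge0}$ with $\gamma(n)>0$ for all $n\ge0$, $$\lim_{n\to\infty}\frac{\gamma(n-1)}{\gamma(n)}=\frac1r,\qquad \sum_{i=0}^\infty\gamma(i)r^{-i}<\infty,\qquad \lim_{m\to\infty}\Bigl(\limsup_{n\to\infty}\frac1{\gamma(n)}\sum_{i=m}^{n-m}\gamma(n-i)\gamma(i)\Bigr)=0.$$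 Membership of $\rho$ in $\mathcal W(r)$ refers to $\{\rho(n)\}_{n\ge0}$. We write $b\in\mathcal W(r)$ if, for some $N\ge1$, the tail $\{b(n+N)\}_{n\ge0}$ belongs to $\mathcal W(r)$. Fix $r\in(0,1)$. Assume that (S2) $\displaystyle\frac{\sigma}{\lambda_1}\Bigl(\sum_{j=1}^\infty z(j)^2\Bigr)^{1/2}<1$, where $\displaystyle\frac1{1-\lambda_1\sum_{j=1}^\infty b(j)x^j}=\sum_{j=0}^\infty z(j)x^j$, and that $\lambda_1\sum_{j=1}^\infty b(j)r^{-j}<\tfrac12$. Then $b\in\mathcal W(r)$ if and only if $\rho\in\mathcal W(r)$. If $b(j)>0$ for all $j\ge1$, then moreover the full sequence $\{b(n+1)\}_{n\ge0}$ belongs to $\mathcal W(r)$ if and only if $\rho\in\mathcal W(r)$. Finally, either of $b\in\mathcal W(r)$ and $\rho\in\mathcal W(r)$ implies that $\mathbb E[\nu(0)^2]<\infty$ and $$\lim_{n\to\infty}\frac{\rho(n)}{b(n)}=\frac{\mathbb E[\nu(0)^2]}{1-\lambda_1\sum_{j=1}^\infty b(j)r^{j}}\cdot\frac{\lambda_1}{\bigl(1-\lambda_1\sum_{j=1}^\infty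 b(j)r^{-j}\bigr)^2}.$$ -/

import Mathlib

open MeasureTheory ProbabilityTheory Filter Topology

namespace ArchInf

/-- The class `W(r)` of positive sequences `γ = (γ(n))_{n ≥ 0}`: `γ(n-1)/γ(n) → 1/r`,
`∑ γ(i) r^{-i} < ∞`, and
`lim_{m → ∞} limsup_{n → ∞} (1/γ(n)) ∑_{i=m}^{n-m} γ(n-i) γ(i) = 0`.
The limsup is taken in the extended reals, so that it is the true one (possibly `+∞`);
the inner sum is empty when `m > n - m`. -/
structure MemW (r : ℝ) (γ : ℕ → ℝ) : Prop where
  pos : ∀ n, 0 < γ n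
  ratio : Tendsto (fun n => γ n / γ (n + 1)) atTop (𝓝 (1 / r))
  summable : Summable (fun i => γ i * (r ^ i)⁻¹)
  conv : Tendsto
    (fun m : ℕ => limsup
      (fun n : ℕ => (((1 / γ n) * ∑ i ∈ Finset.Icc m (n - m), γ (n - i) * γ i : ℝ) : EReal)) atTop)
    atTop (𝓝 0)

/-- A sequence `b = (b(j))_{j ≥ 1}` (the value `b 0` plays no role) is in `W(r)` up to finitely many
initial terms: for some `N ≥ 1` the tail `b(N), b(N+1), …` is in `W(r)`. -/
def TailMemW (r : ℝ) (b : ℕ → ℝ) : Prop :=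
  ∃ N : ℕ, 1 ≤ N ∧ MemW r (fun n => b (n + N))

variable {Ω : Type*} [MeasurableSpace Ω]

/-- The shocks `ξ(k)`, `k ∈ ℤ`: i.i.d. non-negative random variables. -/
structure IsShock (ξ : ℤ → Ω → ℝ) (μ : Measure Ω) : Prop where
  measurable : ∀ k, Measurable (ξ k)
  indep : iIndepFun ξ μ
  ident : ∀ k, IdentDistrib (ξ k) (ξ 0) μ μ
  nonneg : ∀ k, ∀ᵐ ω ∂μ, 0 ≤ ξ k ω

/-- `ς(k) = a + ∑_{j ≥ 1} b(j) X(k-j)`. -/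
noncomputable def vol (a : ℝ) (b : ℕ → ℝ) (X : ℤ → Ω → ℝ) (k : ℤ) (ω : Ω) : ℝ :=
  a + ∑' j : ℕ, b (j + 1) * X (k - ((j : ℤ) + 1)) ω

/-- `X` solves the ARCH(∞) equations `X(k) = ς(k) ξ(k)`, `k ∈ ℤ`, almost surely, the series that
defines `ς(k)` being almost surely convergent. -/
structure IsArchSolution (a : ℝ) (b : ℕ → ℝ) (ξ X : ℤ → Ω → ℝ) (μ : Measure Ω) : Prop where
  measurable : ∀ k, Measurable (X k)
  summable : ∀ k, ∀ᵐ ω ∂μ, Summable (fun j : ℕ => b (j + 1) * X (k - ((j : ℤ) + 1)) ω)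
  eqn : ∀ k, ∀ᵐ ω ∂μ, X k ω = vol a b X k ω * ξ k ω

/-- `X` is weakly stationary with autocovariance function `ρ`. -/
structure IsWeaklyStationary (X : ℤ → Ω → ℝ) (ρ : ℤ → ℝ) (μ : Measure Ω) : Prop where
  memLp : ∀ k, MemLp (X k) 2 μ
  mean : ∀ k, ∫ ω, X k ω ∂μ = ∫ ω, X 0 ω ∂μ
  cov : ∀ n k, cov[X n, X (n + k); μ] = ρ k

/-- The coefficients `z(j)` of `1 / (1 - l ∑_{j ≥ 1} b(j) x^j) = ∑_{j ≥ 0} z(j) x^j`. -/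
noncomputable def resolvent (l : ℝ) (b : ℕ → ℝ) (n : ℕ) : ℝ :=
  PowerSeries.coeff n (PowerSeries.mk (fun j => if j = 0 then (1 : ℝ) else -(l * b j)))⁻¹

/-- The condition `(σ / λ₁) (∑_{j ≥ 1} z(j)²)^{1/2} < 1`, where `λ₁` and `σ²` are the mean and the
variance of `ξ(0)` and `z` is the resolvent of `λ₁ b`. -/
def CondS2 (b : ℕ → ℝ) (ξ : ℤ → Ω → ℝ) (μ : Measure Ω) : Prop :=
  Summable (fun j : ℕ => resolvent (∫ ω, ξ 0 ω ∂μ) b (j + 1) ^ 2) ∧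
    √(Var[ξ 0; μ]) / (∫ ω, ξ 0 ω ∂μ) *
      √(∑' j : ℕ, resolvent (∫ ω, ξ 0 ω ∂μ) b (j + 1) ^ 2) < 1

/-- `ν(k) = X(k) - l ς(k)`, used with `l = λ₁`. -/
noncomputable def innov (l a : ℝ) (b : ℕ → ℝ) (X : ℤ → Ω → ℝ) (k : ℤ) (ω : Ω) : ℝ :=
  X k ω - l * vol a b X k ω

end ArchInf

set_option linter.unusedSectionVars false

namespace ArchInf

/-! ### Subexponential sequences -/

/-- The sequences that are eventually positive, summable, long-tailed and subexponential: up to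
finitely many terms, the class `W(1)`. -/
structure Subexp (p : ℕ → ℝ) : Prop where
  pos : ∀ᶠ n in atTop, 0 < p n
  ratio : Tendsto (fun n => p n / p (n + 1)) atTop (𝓝 1)
  summable : Summable p
  conv : ∀ δ > 0, ∀ᶠ m in atTop, ∀ᶠ n in atTop,
    ∑ i ∈ Finset.Icc m (n - m), p (n - i) * p i ≤ δ * p n

theorem tendsto_div_add {g : ℕ → ℝ} {c : ℝ} (hpos : ∀ᶠ n in atTop, 0 < g n)
    (hg : Tendsto (fun n => g n / g (n + 1)) atTop (𝓝 c)) (k : ℕ) :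
    Tendsto (fun n => g n / g (n + k)) atTop (𝓝 (c ^ k)) := by
  induction k with
  | zero =>
    refine (tendsto_const_nhds (x := c ^ 0)).congr' ?_
    filter_upwards [hpos] with n hn
    simp [hn.ne']
  | succ k ih =>
    have h := ih.mul ((tendsto_add_atTop_iff_nat k).2 hg)
    rw [← pow_succ] at h
    refine h.congr' ?_
    filter_upwards [(tendsto_add_atTop_nat k).eventually hpos] with n hn
    rw [← add_assoc, div_mul_div_cancel₀ hn.ne']

namespace Subexp

variable {p q : ℕ → ℝ}

theorem ratio_add (hp : Subexp p) (k : ℕ) :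
    Tendsto (fun n => p n / p (n + k)) atTop (𝓝 1) := by
  simpa using tendsto_div_add hp.pos hp.ratio k

theorem ratio_sub (hp : Subexp p) (k : ℕ) :
    Tendsto (fun n => p (n - k) / p n) atTop (𝓝 1) := by
  refine ((hp.ratio_add k).comp (tendsto_sub_atTop_nat k)).congr' ?_
  filter_upwards [eventually_ge_atTop k] with n hn
  simp [Nat.sub_add_cancel hn]

theorem ratio_add_inv (hp : Subexp p) (k : ℕ) :
    Tendsto (fun n => p (n + k) / p n) atTop (𝓝 1) := by
  simpa using (hp.ratio_add k).inv₀ one_ne_zero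

theorem sum_Icc_shift (p : ℕ → ℝ) {m n N : ℕ} (h : 2 * m ≤ n) :
    ∑ i ∈ Finset.Icc (m + N) (n + 2 * N - (m + N)), p (n + 2 * N - i) * p i =
      ∑ i ∈ Finset.Icc m (n - m), p (n - i + N) * p (i + N) := by
  refine Finset.sum_nbij' (fun i => i - N) (fun i => i + N) ?_ ?_ ?_ ?_ ?_
  · intro i hi; simp only [Finset.mem_Icc] at hi ⊢; omega
  · intro i hi; simp only [Finset.mem_Icc] at hi ⊢; omega
  · intro i hi; simp only [Finset.mem_Icc] at hi; omega
  · intro i hi; simp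
  · intro i hi
    simp only [Finset.mem_Icc] at hi
    congr 2 <;> omega

theorem shift (hp : Subexp p) (N : ℕ) : Subexp (fun n => p (n + N)) where
  pos := (tendsto_add_atTop_nat N).eventually hp.pos
  ratio := by
    have := (tendsto_add_atTop_iff_nat N).2 hp.ratio
    refine this.congr fun n => ?_
    rw [show n + 1 + N = n + N + 1 by ring]
  summable := (summable_nat_add_iff N).2 hp.summable
  conv := by
    intro δ hδ
    have h1 := (tendsto_add_atTop_nat N).eventually (hp.conv (δ / 2) (by positivity))
    have h2 : ∀ᶠ n in atTop, p (n + N + N) / p (n + N) < 2 :=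
      (tendsto_add_atTop_nat N).eventually
        ((hp.ratio_add_inv N).eventually_lt_const (by norm_num))
    filter_upwards [h1] with m hm
    filter_upwards [(tendsto_add_atTop_nat (2 * N)).eventually hm, h2, eventually_ge_atTop (2 * m),
      (tendsto_add_atTop_nat N).eventually hp.pos] with n hn h3 h4 h5
    rw [sum_Icc_shift p h4] at hn
    refine hn.trans ?_
    rw [div_lt_iff₀ h5, show n + N + N = n + 2 * N by ring] at h3
    nlinarith

theorem of_shift {N : ℕ} (hp : Subexp (fun n => p (n + N))) : Subexp p := by
  have hpos : ∀ᶠ n in atTop, 0 < p n := by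
    filter_upwards [(tendsto_sub_atTop_nat N).eventually hp.pos, eventually_ge_atTop N] with n h h'
    rwa [Nat.sub_add_cancel h'] at h
  have hratio : Tendsto (fun n => p n / p (n + 1)) atTop (𝓝 1) := by
    refine (tendsto_add_atTop_iff_nat N).1 (hp.ratio.congr fun n => ?_)
    rw [show n + 1 + N = n + N + 1 by ring]
  refine ⟨hpos, hratio, (summable_nat_add_iff N).1 hp.summable, fun δ hδ => ?_⟩
  have h1 := hp.conv (δ / 2) (by positivity)
  have h2 : ∀ᶠ n in atTop, p (n + N) / p (n + N + N) < 2 := by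
    have := tendsto_div_add hpos hratio N
    rw [one_pow] at this
    exact (tendsto_add_atTop_nat N).eventually (this.eventually_lt_const (by norm_num))
  have h3 : ∀ᶠ m in atTop, ∀ᶠ n in atTop,
      ∑ i ∈ Finset.Icc (m + N) (n + 2 * N - (m + N)), p (n + 2 * N - i) * p i ≤
        δ * p (n + 2 * N) := by
    filter_upwards [h1] with m hm
    filter_upwards [hm, h2, eventually_ge_atTop (2 * m),
      (tendsto_add_atTop_nat (2 * N)).eventually hpos] with n hn h3 h4 h5
    rw [sum_Icc_shift p h4]
    refine hn.trans ?_
    rw [show n + N + N = n + 2 * N by ring, div_lt_iff₀ h5] at h3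
    nlinarith
  filter_upwards [(tendsto_sub_atTop_nat N).eventually h3, eventually_ge_atTop N] with m hm hmN
  rw [Nat.sub_add_cancel hmN] at hm
  filter_upwards [(tendsto_sub_atTop_nat (2 * N)).eventually hm, eventually_ge_atTop (2 * N)]
    with n hn hnN
  rwa [Nat.sub_add_cancel hnN] at hn

theorem of_div (hp : Subexp p) {c : ℝ} (hc : 0 < c)
    (h : Tendsto (fun n => q n / p n) atTop (𝓝 c)) : Subexp q := by
  have hlow : ∀ᶠ n in atTop, p n ≤ 2 / c * q n := by
    filter_upwards [h.eventually_const_lt (half_lt_self hc), hp.pos] with n hn hpn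
    rw [lt_div_iff₀ hpn] at hn
    rw [div_mul_eq_mul_div, le_div_iff₀ hc]
    linarith
  have hup : ∀ᶠ n in atTop, q n ≤ 2 * c * p n := by
    filter_upwards [h.eventually_lt_const (show c < 2 * c by linarith), hp.pos] with n hn hpn
    rw [div_lt_iff₀ hpn] at hn
    exact hn.le
  have hpos : ∀ᶠ n in atTop, 0 < q n := by
    filter_upwards [hlow, hp.pos] with n h1 h2
    exact (mul_pos_iff_of_pos_left (by positivity)).1 (h2.trans_le h1)
  refine ⟨hpos, ?_, ?_, ?_⟩
  · have h' := (h.mul hp.ratio).mul (((tendsto_add_atTop_iff_nat 1).2 h).inv₀ hc.ne')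
    rw [mul_one, mul_inv_cancel₀ hc.ne'] at h'
    refine h'.congr' ?_
    filter_upwards [hp.pos, (tendsto_add_atTop_nat 1).eventually hp.pos] with n h1 h2
    have h1 := h1.ne'
    have h2 := h2.ne'
    field_simp
  · refine summable_of_isBigO_nat hp.summable (Asymptotics.IsBigO.of_bound (2 * c) ?_)
    filter_upwards [hup, hp.pos, hpos] with n h1 h2 h3
    rwa [Real.norm_of_nonneg h2.le, Real.norm_of_nonneg h3.le]
  · intro δ hδ
    obtain ⟨M, hM⟩ := eventually_atTop.1 (hup.and hpos)
    filter_upwards [hp.conv (δ / (2 * c) ^ 2 * (c / 2)) (by positivity), eventually_ge_atTop M]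
      with m hm hmM
    filter_upwards [hm, hlow] with n hn hlow
    calc ∑ i ∈ Finset.Icc m (n - m), q (n - i) * q i
        ≤ ∑ i ∈ Finset.Icc m (n - m), (2 * c) ^ 2 * (p (n - i) * p i) := by
          refine Finset.sum_le_sum fun i hi => ?_
          simp only [Finset.mem_Icc] at hi
          obtain ⟨h1, h2⟩ := hM i (by omega)
          obtain ⟨h3, h4⟩ := hM (n - i) (by omega)
          calc q (n - i) * q i ≤ (2 * c * p (n - i)) * (2 * c * p i) :=
                mul_le_mul h3 h1 h2.le (h4.le.trans h3)
            _ = _ := by ring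
      _ = (2 * c) ^ 2 * ∑ i ∈ Finset.Icc m (n - m), p (n - i) * p i := by rw [Finset.mul_sum]
      _ ≤ (2 * c) ^ 2 * (δ / (2 * c) ^ 2 * (c / 2) * (2 / c * q n)) := by
          gcongr
          exact hn.trans (by gcongr)
      _ = δ * q n := by field_simp

theorem const_mul (hp : Subexp p) {c : ℝ} (hc : 0 < c) : Subexp (fun n => c * p n) := by
  refine hp.of_div hc ((tendsto_const_nhds (x := c)).congr' ?_)
  filter_upwards [hp.pos] with n hn
  field_simp

end Subexp

theorem memW_iff {r : ℝ} (hr : 0 < r) {γ : ℕ → ℝ} :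
    MemW r γ ↔ (∀ n, 0 < γ n) ∧ Subexp (fun n => γ n * (r ^ n)⁻¹) := by
  have hconv : ∀ m n : ℕ, m ≤ n →
      ∑ i ∈ Finset.Icc m (n - m), γ (n - i) * (r ^ (n - i))⁻¹ * (γ i * (r ^ i)⁻¹) =
        (∑ i ∈ Finset.Icc m (n - m), γ (n - i) * γ i) * (r ^ n)⁻¹ := by
    intro m n _
    rw [Finset.sum_mul]
    refine Finset.sum_congr rfl fun i hi => ?_
    simp only [Finset.mem_Icc] at hi
    have : r ^ n = r ^ (n - i) * r ^ i := by rw [← pow_add]; congr 1; omega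
    rw [this]
    field_simp
  constructor
  · intro h
    refine ⟨h.pos, Eventually.of_forall fun n => mul_pos (h.pos n) (by positivity), ?_,
      h.summable, ?_⟩
    · have := h.ratio.mul_const r
      rw [one_div_mul_cancel hr.ne'] at this
      refine this.congr fun n => ?_
      have := (h.pos (n + 1)).ne'
      rw [pow_succ]
      field_simp
    · intro δ hδ
      filter_upwards [h.conv.eventually_lt_const (show (0 : EReal) < (δ : ℝ) by exact_mod_cast hδ)]
        with m hm
      filter_upwards [eventually_lt_of_limsup_lt hm, eventually_ge_atTop m] with n hn hnm
      rw [EReal.coe_lt_coe_iff, one_div_mul_eq_div, div_lt_iff₀ (h.pos n)] at hn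
      rw [hconv m n hnm, ← mul_assoc]
      gcongr
  · rintro ⟨hpos, h⟩
    refine ⟨hpos, ?_, h.summable, ?_⟩
    · have := h.ratio.mul_const (1 / r)
      rw [one_mul] at this
      refine this.congr fun n => ?_
      have := (hpos (n + 1)).ne'
      rw [pow_succ]
      field_simp
    · refine tendsto_order.2 ⟨fun x hx => ?_, fun x hx => ?_⟩
      · refine Eventually.of_forall fun m => hx.trans_le ?_
        refine le_limsup_of_frequently_le (Eventually.frequently (Eventually.of_forall fun n => ?_))
        rw [← EReal.coe_zero, EReal.coe_le_coe_iff]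
        exact mul_nonneg (one_div_pos.2 (hpos n)).le
          (Finset.sum_nonneg fun i _ => (mul_pos (hpos _) (hpos _)).le)
      · obtain ⟨δ, hδ0, hδ⟩ := EReal.lt_iff_exists_real_btwn.1 hx
        rw [← EReal.coe_zero, EReal.coe_lt_coe_iff] at hδ0
        filter_upwards [h.conv δ hδ0] with m hm
        refine lt_of_le_of_lt ?_ hδ
        refine limsup_le_of_le (by isBoundedDefault) ?_
        filter_upwards [hm, eventually_ge_atTop m] with n hn hnm
        rw [EReal.coe_le_coe_iff, one_div_mul_eq_div, div_le_iff₀ (hpos n)]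
        rw [hconv m n hnm, ← mul_assoc] at hn
        exact le_of_mul_le_mul_right hn (by positivity)

theorem subexp_shift_weighted_iff {r : ℝ} (hr : 0 < r) {γ : ℕ → ℝ} (N : ℕ) :
    Subexp (fun n => γ (n + N) * (r ^ n)⁻¹) ↔ Subexp (fun n => γ n * (r ^ n)⁻¹) := by
  constructor
  · intro h
    refine Subexp.of_shift (N := N) ?_
    convert! h.const_mul (c := (r ^ N)⁻¹) (by positivity) using 2 with n
    rw [pow_add, mul_inv]
    ring
  · intro h
    convert! (h.shift N).const_mul (c := r ^ N) (by positivity) using 2 with n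
    rw [pow_add]
    field_simp

theorem memW_tail_iff {r : ℝ} (hr : 0 < r) {b : ℕ → ℝ} (N : ℕ) :
    MemW r (fun n => b (n + N)) ↔
      (∀ n, N ≤ n → 0 < b n) ∧ Subexp (fun n => b n * (r ^ n)⁻¹) := by
  rw [memW_iff hr, subexp_shift_weighted_iff hr]
  refine and_congr_left fun _ => ⟨fun h n hn => ?_, fun h n => h _ (by omega)⟩
  simpa [Nat.sub_add_cancel hn] using h (n - N)

theorem tailMemW_iff {r : ℝ} (hr : 0 < r) {b : ℕ → ℝ} :
    TailMemW r b ↔ Subexp (fun n => b n * (r ^ n)⁻¹) := by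
  constructor
  · rintro ⟨N, _, h⟩
    exact ((memW_tail_iff hr N).1 h).2
  · intro h
    obtain ⟨N, hN⟩ := eventually_atTop.1 h.pos
    refine ⟨N + 1, by omega, (memW_tail_iff hr (N + 1)).2 ⟨fun n hn => ?_, h⟩⟩
    exact (mul_pos_iff_of_pos_right (by positivity)).1 (hN n (by omega))

/-! ### Renewal equations with a subexponential kernel -/

theorem tendsto_zero_of_contraction {D : ℕ → ℝ} (hD : ∀ n, 0 ≤ D n) {q : ℝ} (hq0 : 0 ≤ q)
    (hq : q < 1) (hb : ∃ A, ∀ᶠ n in atTop, D n ≤ A)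
    (h : ∀ A, (∀ᶠ n in atTop, D n ≤ A) → ∀ η > 0, ∀ᶠ n in atTop, D n ≤ q * A + η) :
    Tendsto D atTop (𝓝 0) := by
  set S : Set ℝ := {A | ∀ᶠ n in atTop, D n ≤ A} with hS
  have hS0 : ∀ A ∈ S, 0 ≤ A := fun A hA => by
    obtain ⟨n, hn⟩ := (show ∀ᶠ n in atTop, D n ≤ A from hA).exists
    exact (hD n).trans hn
  have hSb : BddBelow S := ⟨0, hS0⟩
  have ha0 : 0 ≤ sInf S := le_csInf hb hS0
  have ha : sInf S = 0 := by
    by_contra hne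
    have hpos : 0 < sInf S := lt_of_le_of_ne ha0 (Ne.symm hne)
    set a := sInf S
    have ht : 0 < (1 - q) * a / 4 := by have := sub_pos.2 hq; positivity
    obtain ⟨A, hA, hAa⟩ := exists_lt_of_csInf_lt hb (show sInf S < a + (1 - q) * a / 4 by linarith)
    have h1 : a ≤ q * A + (1 - q) * a / 4 := csInf_le hSb (h A hA _ ht)
    nlinarith
  refine tendsto_order.2 ⟨fun x hx => Eventually.of_forall fun n => hx.trans_le (hD n),
    fun x hx => ?_⟩
  obtain ⟨A, hA, hAx⟩ := exists_lt_of_csInf_lt hb (show sInf S < x by rwa [ha])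
  exact (show ∀ᶠ n in atTop, D n ≤ A from hA).mono fun n hn => hn.trans_lt hAx

theorem sum_range_conv_split (f g : ℕ → ℝ) {m n : ℕ} (h : 2 * m ≤ n) :
    ∑ i ∈ Finset.range (n + 1), f i * g (n - i) =
      ∑ i ∈ Finset.range m, f i * g (n - i) + ∑ i ∈ Finset.range m, g i * f (n - i) +
        ∑ i ∈ Finset.Icc m (n - m), f i * g (n - i) := by
  have h1 : ∑ i ∈ Finset.range m, g i * f (n - i) =
      ∑ i ∈ Finset.Ico (n - m + 1) (n + 1), f i * g (n - i) := by
    refine Finset.sum_nbij' (fun i => n - i) (fun i => n - i) ?_ ?_ ?_ ?_ ?_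
    · intro i hi; simp only [Finset.mem_range, Finset.mem_Ico] at hi ⊢; omega
    · intro i hi; simp only [Finset.mem_range, Finset.mem_Ico] at hi ⊢; omega
    · intro i hi; simp only [Finset.mem_range] at hi; omega
    · intro i hi; simp only [Finset.mem_Ico] at hi; omega
    · intro i hi
      simp only [Finset.mem_range] at hi
      rw [show n - (n - i) = i by omega, mul_comm]
  have h2 : Finset.Icc m (n - m) = Finset.Ico m (n - m + 1) := by
    ext i; simp only [Finset.mem_Icc, Finset.mem_Ico]; omega
  rw [h1, h2, Finset.range_eq_Ico, Finset.range_eq_Ico,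
    ← Finset.sum_Ico_consecutive _ (Nat.zero_le m) (show m ≤ n + 1 by omega),
    ← Finset.sum_Ico_consecutive _ (show m ≤ n - m + 1 by omega) (show n - m + 1 ≤ n + 1 by omega)]
  ring

/-- `u = δ₀ + ε p * u`, where `p` is a non-negative summable sequence of total mass less than `1`
without an atom at `0` and `|ε| = 1`. -/
structure IsRenewal (ε : ℝ) (p u : ℕ → ℝ) : Prop where
  abs_eps : |ε| = 1
  zero : p 0 = 0
  nonneg : ∀ n, 0 ≤ p n
  summable : Summable p
  lt_one : ∑' n, p n < 1
  eqn : ∀ n, u n = (if n = 0 then 1 else 0) + ε * ∑ i ∈ Finset.range (n + 1), p i * u (n - i)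

namespace IsRenewal

variable {ε : ℝ} {p u : ℕ → ℝ}

theorem abs_le (h : IsRenewal ε p u) (n : ℕ) :
    |u n| ≤ (if n = 0 then 1 else 0) + ∑ i ∈ Finset.range (n + 1), p i * |u (n - i)| := by
  rw [h.eqn n]
  refine (abs_add_le _ _).trans (add_le_add (by split_ifs <;> simp) ?_)
  rw [abs_mul, h.abs_eps, one_mul]
  refine (Finset.abs_sum_le_sum_abs _ _).trans (Finset.sum_le_sum fun i _ => ?_)
  rw [abs_mul, abs_of_nonneg (h.nonneg i)]

theorem sum_le (h : IsRenewal ε p u) (m : ℕ) : ∑ i ∈ Finset.range m, p i ≤ ∑' n, p n :=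
  h.summable.sum_le_tsum _ fun i _ => h.nonneg i

theorem summable_abs (h : IsRenewal ε p u) : Summable fun n => |u n| := by
  refine summable_of_sum_range_le (c := 1 / (1 - ∑' n, p n)) (fun n => abs_nonneg _) fun M => ?_
  have hpos : 0 < 1 - ∑' n, p n := sub_pos.2 h.lt_one
  rw [le_div_iff₀ hpos]
  have h1 : ∑ n ∈ Finset.range M, |u n| ≤
      1 + (∑' n, p n) * ∑ n ∈ Finset.range M, |u n| := by
    calc ∑ n ∈ Finset.range M, |u n|
        ≤ ∑ n ∈ Finset.range M, ((if n = 0 then 1 else 0) +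
            ∑ i ∈ Finset.range (n + 1), p i * |u (n - i)|) :=
          Finset.sum_le_sum fun n _ => h.abs_le n
      _ = ∑ n ∈ Finset.range M, (if n = 0 then (1 : ℝ) else 0) +
            ∑ i ∈ Finset.range M, ∑ j ∈ Finset.range (M - i), p i * |u j| := by
          rw [Finset.sum_add_distrib, Finset.sum_range_diag_flip M fun i j => p i * |u j|]
      _ ≤ 1 + ∑ i ∈ Finset.range M, p i * ∑ j ∈ Finset.range M, |u j| := by
          refine add_le_add ?_ (Finset.sum_le_sum fun i _ => ?_)
          · rw [Finset.sum_ite_eq']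
            split_ifs <;> simp
          · rw [← Finset.mul_sum]
            refine mul_le_mul_of_nonneg_left ?_ (h.nonneg i)
            refine Finset.sum_le_sum_of_subset_of_nonneg ?_ fun _ _ _ => abs_nonneg _
            exact Finset.range_subset_range.2 (Nat.sub_le _ _)
      _ ≤ 1 + (∑' n, p n) * ∑ n ∈ Finset.range M, |u n| := by
          rw [← Finset.sum_mul]
          gcongr
          exact h.sum_le M
  linarith

theorem tsum_eq (h : IsRenewal ε p u) : ∑' n, u n = 1 + ε * ((∑' n, p n) * ∑' n, u n) := by
  have hu : Summable u := h.summable_abs.of_abs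
  have hs := summable_norm_sum_mul_range_of_summable_norm (f := p) (g := u) h.summable.norm
    h.summable_abs
  rw [tsum_mul_tsum_eq_tsum_sum_range_of_summable_norm h.summable.norm h.summable_abs,
    ← tsum_mul_left]
  rw [tsum_congr h.eqn, Summable.tsum_add _ (hs.of_norm.mul_left ε), tsum_ite_eq]
  exact (hasSum_ite_eq 0 (1 : ℝ)).summable

theorem one_sub_pos (h : IsRenewal ε p u) : 0 < 1 - ε * ∑' n, p n := by
  have h1 : ε * ∑' n, p n ≤ |ε| * ∑' n, p n :=
    mul_le_mul_of_nonneg_right (le_abs_self ε) (tsum_nonneg h.nonneg)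
  rw [h.abs_eps, one_mul] at h1
  linarith [h.lt_one]

theorem tsum_eq_div (h : IsRenewal ε p u) : ∑' n, u n = 1 / (1 - ε * ∑' n, p n) := by
  rw [eq_div_iff h.one_sub_pos.ne']
  linear_combination h.tsum_eq

theorem exists_bound (h : IsRenewal ε p u) (hp : Subexp p) :
    ∃ K N, 0 ≤ K ∧ ∀ n ≥ N, |u n| ≤ K * p n := by
  set φ := ∑' n, p n with hφ
  have hφ0 : 0 ≤ φ := tsum_nonneg h.nonneg
  have hφ1 : φ < 1 := h.lt_one
  obtain ⟨δ, hδ0, hδ⟩ : ∃ δ > 0, φ * (1 + δ) + δ < 1 :=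
    ⟨(1 - φ) / 4, by linarith, by nlinarith⟩
  obtain ⟨N, hN⟩ := eventually_atTop.1 hp.pos
  obtain ⟨m, hm, hmN, hm1⟩ := ((hp.conv δ hδ0).and
    ((eventually_ge_atTop N).and (eventually_ge_atTop 1))).exists
  have hsub : ∀ᶠ n in atTop, ∀ i ∈ Finset.range m, p (n - i) ≤ (1 + δ) * p n := by
    refine (Filter.eventually_all_finset _).2 fun i _ => ?_
    filter_upwards [(hp.ratio_sub i).eventually_lt_const (show 1 < 1 + δ by linarith), hp.pos]
      with n hn hpn
    exact ((div_lt_iff₀ hpn).1 hn).le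
  obtain ⟨n₁, hn₁⟩ := eventually_atTop.1
    (hm.and (hsub.and (eventually_ge_atTop (2 * m + N + 1))))
  set C := (1 + δ) * ∑' n, |u n| with hC
  have hU0 : 0 ≤ ∑' n, |u n| := tsum_nonneg fun n => abs_nonneg (u n)
  have hC0 : 0 ≤ C := by positivity
  set B := ∑ k ∈ Finset.range n₁, |u k| / |p k| with hB
  set K := max B (C / (1 - (φ * (1 + δ) + δ))) with hK
  have hden : 0 < 1 - (φ * (1 + δ) + δ) := sub_pos.2 hδ
  have hK0 : 0 ≤ K := le_max_of_le_right (by positivity)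
  have hKC : K * (φ * (1 + δ) + δ) + C ≤ K := by
    have := (div_le_iff₀ hden).1 (le_max_right B (C / (1 - (φ * (1 + δ) + δ))))
    rw [← hK] at this
    linarith
  refine ⟨K, N, hK0, fun n => ?_⟩
  induction n using Nat.strong_induction_on with
  | _ n ih =>
    intro hnN
    have hpn := hN n hnN
    by_cases hlt : n < n₁
    · have h1 : |u n| / |p n| ≤ B := Finset.single_le_sum (f := fun k => |u k| / |p k|)
        (fun k _ => by positivity) (Finset.mem_range.2 hlt)
      rw [abs_of_pos hpn, div_le_iff₀ hpn] at h1
      exact h1.trans (mul_le_mul_of_nonneg_right (le_max_left _ _) hpn.le)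
    · obtain ⟨hmid, hsub, hn2⟩ := hn₁ n (not_lt.1 hlt)
      have h0 := h.abs_le n
      rw [if_neg (by omega), zero_add, sum_range_conv_split p (fun i => |u i|)
        (show 2 * m ≤ n by omega)] at h0
      have e1 : ∑ i ∈ Finset.range m, p i * |u (n - i)| ≤ φ * (K * ((1 + δ) * p n)) := by
        calc ∑ i ∈ Finset.range m, p i * |u (n - i)|
            ≤ ∑ i ∈ Finset.range m, p i * (K * ((1 + δ) * p n)) := by
              refine Finset.sum_le_sum fun i hi => ?_
              rcases Nat.eq_zero_or_pos i with rfl | hi0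
              · simp [h.zero]
              · have hi' := Finset.mem_range.1 hi
                refine mul_le_mul_of_nonneg_left ?_ (h.nonneg i)
                exact (ih (n - i) (by omega) (by omega)).trans
                  (mul_le_mul_of_nonneg_left (hsub i hi) hK0)
          _ ≤ _ := by
              rw [← Finset.sum_mul]
              exact mul_le_mul_of_nonneg_right (h.sum_le m) (by positivity)
      have e2 : ∑ i ∈ Finset.range m, |u i| * p (n - i) ≤ C * p n := by
        calc ∑ i ∈ Finset.range m, |u i| * p (n - i)
            ≤ ∑ i ∈ Finset.range m, |u i| * ((1 + δ) * p n) :=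
              Finset.sum_le_sum fun i hi => mul_le_mul_of_nonneg_left (hsub i hi) (abs_nonneg _)
          _ = (∑ i ∈ Finset.range m, |u i|) * ((1 + δ) * p n) := by rw [Finset.sum_mul]
          _ ≤ (∑' n, |u n|) * ((1 + δ) * p n) :=
              mul_le_mul_of_nonneg_right
                (h.summable_abs.sum_le_tsum _ fun i _ => abs_nonneg _) (by positivity)
          _ = C * p n := by rw [hC]; ring
      have e3 : ∑ i ∈ Finset.Icc m (n - m), p i * |u (n - i)| ≤ K * (δ * p n) := by
        calc ∑ i ∈ Finset.Icc m (n - m), p i * |u (n - i)|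
            ≤ ∑ i ∈ Finset.Icc m (n - m), K * (p (n - i) * p i) := by
              refine Finset.sum_le_sum fun i hi => ?_
              simp only [Finset.mem_Icc] at hi
              have := mul_le_mul_of_nonneg_left (ih (n - i) (by omega) (by omega)) (h.nonneg i)
              linarith
          _ = K * ∑ i ∈ Finset.Icc m (n - m), p (n - i) * p i := by rw [Finset.mul_sum]
          _ ≤ _ := mul_le_mul_of_nonneg_left hmid hK0
      have e4 := mul_le_mul_of_nonneg_right hKC hpn.le
      nlinarith

/-- A renewal sequence with a subexponential kernel is asymptotically proportional to the
kernel. -/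
theorem tendsto_div (h : IsRenewal ε p u) (hp : Subexp p) :
    Tendsto (fun n => u n / p n) atTop (𝓝 (ε / (1 - ε * ∑' n, p n) ^ 2)) := by
  have hU := h.tsum_eq_div
  have hUs : Summable u := h.summable_abs.of_abs
  have hpos1 := h.one_sub_pos
  obtain ⟨K, N, hK0, hK⟩ := h.exists_bound hp
  obtain ⟨N', hN'⟩ := eventually_atTop.1 hp.pos
  set φ := ∑' n, p n with hφ
  have hφ0 : 0 ≤ φ := tsum_nonneg h.nonneg
  have hφ1 : φ < 1 := h.lt_one
  set U := ∑' n, u n with hUdef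
  set ℓ := ε / (1 - ε * φ) ^ 2 with hℓ
  have hℓeq : ℓ = ε * (φ * ℓ + U) := by
    rw [hU, hℓ]; field_simp; ring
  have hKr : ∀ n, N ≤ n → N' ≤ n → |u n / p n| ≤ K := fun n h1 h2 => by
    rw [abs_div, abs_of_pos (hN' n h2), div_le_iff₀ (hN' n h2)]
    exact hK n h1
  rw [tendsto_iff_norm_sub_tendsto_zero]
  simp only [Real.norm_eq_abs]
  refine tendsto_zero_of_contraction (fun n => abs_nonneg _) hφ0 hφ1 ⟨K + |ℓ|, ?_⟩ ?_
  · filter_upwards [eventually_ge_atTop N, eventually_ge_atTop N'] with n h1 h2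
    exact (abs_sub _ _).trans (add_le_add (hKr n h1 h2) le_rfl)
  intro A hA η hη
  obtain ⟨N₂, hN₂⟩ := eventually_atTop.1 hA
  have hlim : Tendsto (fun m => ∑ i ∈ Finset.range m, u i + ℓ * ∑ i ∈ Finset.range m, p i)
      atTop (𝓝 (U + ℓ * φ)) :=
    hUs.hasSum.tendsto_sum_nat.add (h.summable.hasSum.tendsto_sum_nat.const_mul ℓ)
  obtain ⟨m, hmid, hmlim, hm1, hm2, hm3⟩ := ((hp.conv (η / (4 * (K + 1))) (by positivity)).and
    ((hlim.eventually (Metric.ball_mem_nhds _ (show 0 < η / 4 by positivity))).and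
      ((eventually_ge_atTop N).and ((eventually_ge_atTop N').and (eventually_ge_atTop 1))))).exists
  rw [Real.dist_eq] at hmlim
  have hE1 : Tendsto (fun n => ∑ i ∈ Finset.range m,
      p i * (u (n - i) / p (n - i) * (p (n - i) / p n - 1))) atTop (𝓝 0) := by
    rw [show (0 : ℝ) = ∑ i ∈ Finset.range m, 0 by simp]
    refine tendsto_finsetSum _ fun i _ => ?_
    have h1 : Tendsto (fun n => p i * (K * |p (n - i) / p n - 1|)) atTop (𝓝 0) := by
      have := (((hp.ratio_sub i).sub_const 1).abs.const_mul K).const_mul (p i)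
      simpa using this
    refine squeeze_zero_norm' ?_ h1
    filter_upwards [eventually_ge_atTop (N + N' + i)] with n hn
    rw [Real.norm_eq_abs, abs_mul, abs_mul, abs_of_nonneg (h.nonneg i)]
    gcongr
    · exact h.nonneg i
    · exact hKr _ (by omega) (by omega)
  have hE2 : Tendsto (fun n => ∑ i ∈ Finset.range m, u i * (p (n - i) / p n)) atTop
      (𝓝 (∑ i ∈ Finset.range m, u i)) := by
    refine tendsto_finsetSum _ fun i _ => ?_
    simpa using (hp.ratio_sub i).const_mul (u i)
  have hE : Tendsto (fun n => ∑ i ∈ Finset.range m,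
      p i * (u (n - i) / p (n - i) * (p (n - i) / p n - 1)) +
      ∑ i ∈ Finset.range m, u i * (p (n - i) / p n)) atTop (𝓝 (∑ i ∈ Finset.range m, u i)) := by
    simpa using hE1.add hE2
  filter_upwards [hmid, hE.eventually (Metric.ball_mem_nhds _ (show 0 < η / 4 by positivity)),
    eventually_ge_atTop (2 * m + N + N' + N₂ + 1)] with n hmidn hEn hn
  rw [Real.dist_eq] at hEn
  have hpn := hN' n (by omega)
  have hA0 : 0 ≤ A := (abs_nonneg _).trans (hN₂ n (by omega))
  have hun := h.eqn n
  rw [if_neg (by omega), zero_add, sum_range_conv_split p u (show 2 * m ≤ n by omega)] at hun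
  set E := ∑ i ∈ Finset.range m, p i * (u (n - i) / p (n - i) * (p (n - i) / p n - 1)) +
      ∑ i ∈ Finset.range m, u i * (p (n - i) / p n) with hEdef
  set F := ∑ i ∈ Finset.range m, p i * (u (n - i) / p (n - i) - ℓ) with hFdef
  set M := ∑ i ∈ Finset.Icc m (n - m), p i * u (n - i) with hMdef
  have hF : |F| ≤ φ * A := by
    refine (Finset.abs_sum_le_sum_abs _ _).trans ?_
    calc ∑ i ∈ Finset.range m, |p i * (u (n - i) / p (n - i) - ℓ)|
        ≤ ∑ i ∈ Finset.range m, p i * A := by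
          refine Finset.sum_le_sum fun i hi => ?_
          have hi' := Finset.mem_range.1 hi
          rw [abs_mul, abs_of_nonneg (h.nonneg i)]
          exact mul_le_mul_of_nonneg_left (hN₂ _ (by omega)) (h.nonneg i)
      _ ≤ φ * A := by
          rw [← Finset.sum_mul]
          exact mul_le_mul_of_nonneg_right (h.sum_le m) hA0
  have hM : |M / p n| ≤ η / 4 := by
    rw [abs_div, abs_of_pos hpn, div_le_iff₀ hpn]
    calc |M| ≤ ∑ i ∈ Finset.Icc m (n - m), |p i * u (n - i)| := Finset.abs_sum_le_sum_abs _ _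
      _ ≤ ∑ i ∈ Finset.Icc m (n - m), K * (p (n - i) * p i) := by
          refine Finset.sum_le_sum fun i hi => ?_
          simp only [Finset.mem_Icc] at hi
          rw [abs_mul, abs_of_nonneg (h.nonneg i)]
          have := mul_le_mul_of_nonneg_left (hK (n - i) (by omega)) (h.nonneg i)
          linarith
      _ = K * ∑ i ∈ Finset.Icc m (n - m), p (n - i) * p i := by rw [Finset.mul_sum]
      _ ≤ (K + 1) * (η / (4 * (K + 1)) * p n) := by
          refine mul_le_mul (by linarith) hmidn ?_ (by positivity)
          exact Finset.sum_nonneg fun i _ => mul_nonneg (h.nonneg _) (h.nonneg _)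
      _ = η / 4 * p n := by field_simp
  have hkey : u n / p n - ℓ = ε * (F + (E - ∑ i ∈ Finset.range m, u i) +
      (∑ i ∈ Finset.range m, u i + ℓ * ∑ i ∈ Finset.range m, p i - (U + ℓ * φ)) + M / p n) := by
    have h1 : (∑ i ∈ Finset.range m, p i * u (n - i)) / p n = F + ℓ * ∑ i ∈ Finset.range m, p i +
        ∑ i ∈ Finset.range m, p i * (u (n - i) / p (n - i) * (p (n - i) / p n - 1)) := by
      rw [Finset.sum_div, hFdef, Finset.mul_sum, ← Finset.sum_add_distrib,
        ← Finset.sum_add_distrib]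
      refine Finset.sum_congr rfl fun i hi => ?_
      have hi' := Finset.mem_range.1 hi
      have := (hN' (n - i) (by omega)).ne'
      field_simp
      ring
    have h2 : (∑ i ∈ Finset.range m, u i * p (n - i)) / p n =
        ∑ i ∈ Finset.range m, u i * (p (n - i) / p n) := by
      rw [Finset.sum_div]
      exact Finset.sum_congr rfl fun i _ => mul_div_assoc _ _ _
    rw [hun, mul_div_assoc, add_div, add_div, h1, h2]
    linear_combination -hℓeq
  rw [hkey, abs_mul, h.abs_eps, one_mul]
  refine (abs_add_le _ _).trans ?_
  have h3 := abs_add_le (F + (E - ∑ i ∈ Finset.range m, u i))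
    (∑ i ∈ Finset.range m, u i + ℓ * ∑ i ∈ Finset.range m, p i - (U + ℓ * φ))
  have h4 := abs_add_le F (E - ∑ i ∈ Finset.range m, u i)
  linarith

end IsRenewal

/-- Weighted forward sums of a sequence whose ratio converges to `r < 1`. -/
theorem tendsto_tsum_forward {g w : ℕ → ℝ} {r : ℝ} (hr0 : 0 < r) (hr1 : r < 1)
    (hpos : ∀ᶠ n in atTop, 0 < g n)
    (hg : Tendsto (fun n => g n / g (n + 1)) atTop (𝓝 (1 / r)))
    (hw0 : ∀ n, 0 ≤ w n) (hw : Summable w) :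
    Tendsto (fun n => (∑' j, w j * g (n + j)) / g n) atTop (𝓝 (∑' j, w j * r ^ j)) := by
  have hlim : ∀ j, Tendsto (fun n => g (n + j) / g n) atTop (𝓝 (r ^ j)) := fun j => by
    have := (tendsto_div_add hpos hg j).inv₀ (by positivity)
    simpa using this
  have hdec : ∀ᶠ n in atTop, g (n + 1) ≤ g n := by
    filter_upwards [(hlim 1).eventually_lt_const (show r ^ 1 < 1 by simpa using hr1), hpos]
      with n hn hgn
    exact ((div_lt_one hgn).1 hn).le
  obtain ⟨N, hN⟩ := eventually_atTop.1 (hdec.and hpos)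
  have hbd : ∀ n ≥ N, ∀ j, g (n + j) ≤ g n := fun n hn j => by
    induction j with
    | zero => simp
    | succ j ih => exact ((hN (n + j) (by omega)).1).trans ih
  have := tendsto_tsum_of_dominated_convergence (𝓕 := atTop)
    (f := fun n j => w j * (g (n + j) / g n)) (g := fun j => w j * r ^ j) hw
    (fun j => (hlim j).const_mul (w j)) (by
      filter_upwards [eventually_ge_atTop N] with n hn j
      have h1 := (hN n hn).2
      have h2 := (hN (n + j) (by omega)).2
      rw [Real.norm_of_nonneg (mul_nonneg (hw0 j) (by positivity))]
      exact mul_le_of_le_one_right (hw0 j) ((div_le_one h1).2 (hbd n hn j)))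
  refine this.congr fun n => ?_
  rw [div_eq_mul_inv, ← tsum_mul_right]
  exact tsum_congr fun j => by rw [div_eq_mul_inv, mul_assoc]

/-! ### Autoregressive coefficients, their resolvent, and the autocovariances -/

/-- The autoregressive coefficients `l b(j)`, `j ≥ 1`, with the value `0` at `j = 0`. -/
noncomputable def arCoeff (l : ℝ) (b : ℕ → ℝ) (j : ℕ) : ℝ := if j = 0 then 0 else l * b j

theorem eqn_of_powerSeries {ε : ℝ} {p u : ℕ → ℝ}
    (h : PowerSeries.mk u = 1 + ε • (PowerSeries.mk p * PowerSeries.mk u)) (n : ℕ) :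
    u n = (if n = 0 then 1 else 0) + ε * ∑ i ∈ Finset.range (n + 1), p i * u (n - i) := by
  have := congrArg (PowerSeries.coeff n) h
  simpa [PowerSeries.coeff_mul, PowerSeries.coeff_one,
    Finset.Nat.sum_antidiagonal_eq_sum_range_succ_mk] using this

theorem mk_resolvent (l : ℝ) (b : ℕ → ℝ) :
    (1 - PowerSeries.mk (arCoeff l b)) * PowerSeries.mk (resolvent l b) = 1 := by
  have h1 : PowerSeries.mk (fun j => if j = 0 then (1 : ℝ) else -(l * b j)) =
      1 - PowerSeries.mk (arCoeff l b) := by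
    ext n
    rw [map_sub, PowerSeries.coeff_one, PowerSeries.coeff_mk, PowerSeries.coeff_mk, arCoeff]
    split_ifs <;> simp
  have h2 : PowerSeries.mk (resolvent l b) = (1 - PowerSeries.mk (arCoeff l b))⁻¹ := by
    ext n
    rw [PowerSeries.coeff_mk, resolvent, h1]
  rw [h2]
  refine PowerSeries.mul_inv_cancel _ ?_
  rw [← h1]
  simp [← PowerSeries.coeff_zero_eq_constantCoeff_apply]

theorem resolvent_eqn (l : ℝ) (b : ℕ → ℝ) (n : ℕ) :
    resolvent l b n = (if n = 0 then 1 else 0) +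
      1 * ∑ i ∈ Finset.range (n + 1), arCoeff l b i * resolvent l b (n - i) := by
  refine eqn_of_powerSeries ?_ n
  rw [one_smul]
  linear_combination mk_resolvent l b

theorem arCoeff_eqn (l : ℝ) (b : ℕ → ℝ) (n : ℕ) :
    ((if n = 0 then 1 else 0) - arCoeff l b n) = (if n = 0 then 1 else 0) +
      (-1) * ∑ i ∈ Finset.range (n + 1), (resolvent l b i - if i = 0 then 1 else 0) *
        ((if n - i = 0 then 1 else 0) - arCoeff l b (n - i)) := by
  refine eqn_of_powerSeries (p := fun i => resolvent l b i - if i = 0 then 1 else 0)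
    (u := fun n => (if n = 0 then 1 else 0) - arCoeff l b n) ?_ n
  have h1 : PowerSeries.mk (fun i => resolvent l b i - if i = 0 then 1 else 0) =
      PowerSeries.mk (resolvent l b) - 1 := by
    ext n; simp [PowerSeries.coeff_one]
  have h2 : PowerSeries.mk (fun n => (if n = 0 then 1 else 0) - arCoeff l b n) =
      1 - PowerSeries.mk (arCoeff l b) := by
    ext n; simp [PowerSeries.coeff_one]
  rw [h1, h2, neg_one_smul]
  linear_combination mk_resolvent l b

theorem eqn_weighted {ε : ℝ} {p u : ℕ → ℝ} (x : ℝ)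
    (h : ∀ n, u n = (if n = 0 then 1 else 0) + ε * ∑ i ∈ Finset.range (n + 1), p i * u (n - i))
    (n : ℕ) :
    u n * x ^ n = (if n = 0 then 1 else 0) +
      ε * ∑ i ∈ Finset.range (n + 1), p i * x ^ i * (u (n - i) * x ^ (n - i)) := by
  have h1 : ∑ i ∈ Finset.range (n + 1), p i * x ^ i * (u (n - i) * x ^ (n - i)) =
      (∑ i ∈ Finset.range (n + 1), p i * u (n - i)) * x ^ n := by
    rw [Finset.sum_mul]
    refine Finset.sum_congr rfl fun i hi => ?_
    have hi' := Finset.mem_range.1 hi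
    rw [show x ^ n = x ^ i * x ^ (n - i) by rw [← pow_add]; congr 1; omega]
    ring
  rw [h1]
  rcases Nat.eq_zero_or_pos n with rfl | hn
  · simpa using h 0
  · have := h n
    rw [if_neg hn.ne'] at this ⊢
    linear_combination x ^ n * this

theorem resolvent_nonneg {l : ℝ} {b : ℕ → ℝ} (h : ∀ n, 0 ≤ arCoeff l b n) (n : ℕ) :
    0 ≤ resolvent l b n := by
  induction n using Nat.strong_induction_on with
  | _ n ih =>
    rw [resolvent_eqn, one_mul]
    refine add_nonneg (by split_ifs <;> simp) (Finset.sum_nonneg fun i _ => ?_)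
    rcases Nat.eq_zero_or_pos i with rfl | hi
    · simp [arCoeff]
    · rcases Nat.eq_zero_or_pos n with rfl | hn
      · simp_all [arCoeff]
      · exact mul_nonneg (h i) (ih _ (by omega))

theorem resolvent_zero (l : ℝ) (b : ℕ → ℝ) : resolvent l b 0 = 1 := by
  rw [resolvent_eqn]; simp [arCoeff]

/-- The resolvent as a renewal sequence, with exponential weights. -/
theorem isRenewal_resolvent {l x : ℝ} {b : ℕ → ℝ} (hx : 0 ≤ x) (h : ∀ n, 0 ≤ arCoeff l b n)
    (hs : Summable fun n => arCoeff l b n * x ^ n) (hlt : ∑' n, arCoeff l b n * x ^ n < 1) :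
    IsRenewal 1 (fun n => arCoeff l b n * x ^ n) (fun n => resolvent l b n * x ^ n) where
  abs_eps := abs_one
  zero := by simp [arCoeff]
  nonneg n := mul_nonneg (h n) (pow_nonneg hx n)
  summable := hs
  lt_one := hlt
  eqn := eqn_weighted x (resolvent_eqn l b)

/-- Reordering of a double sum along antidiagonals. -/
theorem tsum_tsum_eq_tsum_conv {f g h : ℕ → ℝ} (hf : Summable fun n => |f n|)
    (hg : Summable fun n => |g n|) {C : ℝ} (hh : ∀ n, |h n| ≤ C) :
    ∑' i, f i * ∑' j, g j * h (i + j) =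
      ∑' k, (∑ i ∈ Finset.range (k + 1), f i * g (k - i)) * h k := by
  have hF : Summable fun x : ℕ × ℕ => f x.1 * (g x.2 * h (x.1 + x.2)) := by
    refine Summable.of_norm_bounded ((hf.mul_of_nonneg hg (fun _ => abs_nonneg _)
      (fun _ => abs_nonneg _)).mul_right C) fun x => ?_
    rw [Real.norm_eq_abs, abs_mul, abs_mul, ← mul_assoc]
    exact mul_le_mul_of_nonneg_left (hh _) (by positivity)
  have h1 := hF.tsum_prod
  simp only [tsum_mul_left] at h1
  rw [← h1, ← Finset.HasAntidiagonal.sigmaAntidiagonalEquivProd.tsum_eq]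
  have hF' := Finset.HasAntidiagonal.sigmaAntidiagonalEquivProd.summable_iff.2 hF
  refine (Summable.tsum_sigma' (fun n => (hasSum_fintype _).summable) hF').trans
    (tsum_congr fun k => ?_)
  simp only [Function.comp_apply, Finset.HasAntidiagonal.sigmaAntidiagonalEquivProd_apply]
  rw [tsum_fintype, Finset.sum_coe_sort (Finset.HasAntidiagonal.antidiagonal k)
    (fun x : ℕ × ℕ => f x.1 * (g x.2 * h (x.1 + x.2))),
    Finset.Nat.sum_antidiagonal_eq_sum_range_succ_mk, Finset.sum_mul]
  refine Finset.sum_congr rfl fun i hi => ?_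
  have hi' := Finset.mem_range.1 hi
  rw [show i + (k - i) = k by omega]
  ring

/-- The data on which the asymptotics of the autocovariances `ρ` depend. -/
structure IsArAutocov (l r s : ℝ) (b ρ : ℕ → ℝ) : Prop where
  r_pos : 0 < r
  r_lt_one : r < 1
  s_pos : 0 < s
  nonneg : ∀ n, 0 ≤ arCoeff l b n
  summable : Summable fun n => arCoeff l b n * (r⁻¹) ^ n
  lt_half : ∑' n, arCoeff l b n * (r⁻¹) ^ n < 1 / 2
  bounded : ∃ C, ∀ n, |ρ n| ≤ C
  eqn : ∀ n, ρ n - ∑' j, arCoeff l b j * ρ (n + j) = s * resolvent l b n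

namespace IsArAutocov

variable {l r s : ℝ} {b ρ : ℕ → ℝ}

theorem one_le_inv_pow (h : IsArAutocov l r s b ρ) (n : ℕ) : 1 ≤ (r⁻¹) ^ n :=
  one_le_pow₀ ((one_le_inv₀ h.r_pos).2 h.r_lt_one.le)

theorem le_weighted (h : IsArAutocov l r s b ρ) {x : ℝ} (hx0 : 0 ≤ x) (hx1 : x ≤ 1) (n : ℕ) :
    arCoeff l b n * x ^ n ≤ arCoeff l b n * (r⁻¹) ^ n :=
  mul_le_mul_of_nonneg_left ((pow_le_one₀ hx0 hx1).trans (h.one_le_inv_pow n)) (h.nonneg n)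

theorem isRenewal (h : IsArAutocov l r s b ρ) {x : ℝ} (hx0 : 0 ≤ x) (hx1 : x ≤ 1) :
    IsRenewal 1 (fun n => arCoeff l b n * x ^ n) (fun n => resolvent l b n * x ^ n) := by
  have hs := h.summable.of_nonneg_of_le
    (fun n => mul_nonneg (h.nonneg n) (pow_nonneg hx0 n)) (h.le_weighted hx0 hx1)
  refine isRenewal_resolvent hx0 h.nonneg hs ?_
  have := hs.tsum_le_tsum (h.le_weighted hx0 hx1) h.summable
  linarith [h.lt_half]

theorem isRenewal_inv (h : IsArAutocov l r s b ρ) :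
    IsRenewal 1 (fun n => arCoeff l b n * (r⁻¹) ^ n) (fun n => resolvent l b n * (r⁻¹) ^ n) :=
  isRenewal_resolvent (inv_nonneg.2 h.r_pos.le) h.nonneg h.summable (by linarith [h.lt_half])

theorem summable_arCoeff (h : IsArAutocov l r s b ρ) : Summable (arCoeff l b) := by
  simpa using (h.isRenewal zero_le_one le_rfl).summable

theorem summable_resolvent (h : IsArAutocov l r s b ρ) : Summable (resolvent l b) := by
  simpa using (h.isRenewal zero_le_one le_rfl).summable_abs.of_abs

theorem resolvent_nonneg (h : IsArAutocov l r s b ρ) (n : ℕ) : 0 ≤ resolvent l b n :=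
  ArchInf.resolvent_nonneg h.nonneg n

/-- The moving average representation of the autocovariances. -/
theorem eq_tsum (h : IsArAutocov l r s b ρ) (n : ℕ) :
    ρ n = s * ∑' j, resolvent l b j * resolvent l b (n + j) := by
  obtain ⟨C, hC⟩ := h.bounded
  have hz := h.summable_resolvent
  have hβ := h.summable_arCoeff
  have hzρ : Summable fun i => resolvent l b i * ρ (n + i) := by
    refine Summable.of_norm_bounded (hz.mul_right C) fun i => ?_
    rw [norm_mul, Real.norm_of_nonneg (h.resolvent_nonneg i)]
    exact mul_le_mul_of_nonneg_left (hC _) (h.resolvent_nonneg i)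
  have hzβ : Summable fun i => resolvent l b i * ∑' j, arCoeff l b j * ρ (n + (i + j)) := by
    refine Summable.of_norm_bounded (hz.mul_right ((∑' j, arCoeff l b j) * C)) fun i => ?_
    rw [norm_mul, Real.norm_of_nonneg (h.resolvent_nonneg i)]
    refine mul_le_mul_of_nonneg_left ?_ (h.resolvent_nonneg i)
    refine tsum_of_norm_bounded (hβ.hasSum.mul_right C) fun j => ?_
    rw [norm_mul, Real.norm_of_nonneg (h.nonneg j)]
    exact mul_le_mul_of_nonneg_left (hC _) (h.nonneg j)
  have h1 := tsum_tsum_eq_tsum_conv hz.abs hβ.abs (h := fun k => ρ (n + k)) fun k => hC (n + k)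
  have h2 : ∀ k, (∑ i ∈ Finset.range (k + 1), resolvent l b i * arCoeff l b (k - i)) =
      resolvent l b k - if k = 0 then 1 else 0 := fun k => by
    have := resolvent_eqn l b k
    rw [one_mul, ← Finset.sum_range_reflect] at this
    rw [eq_sub_iff_add_eq, this, add_comm]
    congr 1
    refine Finset.sum_congr rfl fun i hi => ?_
    have hi' := Finset.mem_range.1 hi
    rw [show k - (k + 1 - 1 - i) = i by omega, show k + 1 - 1 - i = k - i by omega, mul_comm]
  have h3 : ∑' k, (resolvent l b k - if k = 0 then 1 else 0) * ρ (n + k) =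
      ∑' k, resolvent l b k * ρ (n + k) - ρ n := by
    have h4 : ∀ k, (resolvent l b k - if k = 0 then 1 else 0) * ρ (n + k) =
        resolvent l b k * ρ (n + k) - if k = 0 then ρ n else 0 := fun k => by
      split_ifs with hk
      · subst hk; simp; ring
      · ring
    rw [tsum_congr h4, hzρ.tsum_sub (hasSum_ite_eq 0 (ρ n)).summable, tsum_ite_eq]
  simp only [h2, h3] at h1
  have h5 : ∀ j, s * (resolvent l b j * resolvent l b (n + j)) =
      resolvent l b j * ρ (n + j) -
        resolvent l b j * ∑' k, arCoeff l b k * ρ (n + (j + k)) := fun j => by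
    have := h.eqn (n + j)
    simp only [add_assoc] at this
    linear_combination -resolvent l b j * this
  rw [← tsum_mul_left, tsum_congr h5, hzρ.tsum_sub hzβ]
  linear_combination h1

theorem summable_resolvent_mul (h : IsArAutocov l r s b ρ) (n : ℕ) :
    Summable fun j => resolvent l b j * resolvent l b (n + j) := by
  have hz := h.summable_resolvent
  refine (hz.mul_right (∑' i, resolvent l b i)).of_nonneg_of_le
    (fun j => mul_nonneg (h.resolvent_nonneg _) (h.resolvent_nonneg _)) fun j => ?_
  exact mul_le_mul_of_nonneg_left (hz.le_tsum _ fun i _ => h.resolvent_nonneg i)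
    (h.resolvent_nonneg j)

theorem ratio_of_subexp {g : ℕ → ℝ} (hr : 0 < r) (hg : Subexp fun n => g n * (r⁻¹) ^ n) :
    (∀ᶠ n in atTop, 0 < g n) ∧ Tendsto (fun n => g n / g (n + 1)) atTop (𝓝 (1 / r)) := by
  have hpos : ∀ᶠ n in atTop, 0 < g n :=
    hg.pos.mono fun n hn => (mul_pos_iff_of_pos_right (by positivity)).1 hn
  refine ⟨hpos, ?_⟩
  have := hg.ratio.mul_const (1 / r)
  rw [one_mul] at this
  refine this.congr' ?_
  filter_upwards [(tendsto_add_atTop_nat 1).eventually hpos] with n hn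
  have := hn.ne'
  rw [pow_succ]
  field_simp

theorem tendsto_resolvent_div (h : IsArAutocov l r s b ρ)
    (hb : Subexp fun n => arCoeff l b n * (r⁻¹) ^ n) :
    Tendsto (fun n => resolvent l b n / arCoeff l b n) atTop
      (𝓝 (1 / (1 - ∑' n, arCoeff l b n * (r⁻¹) ^ n) ^ 2)) := by
  have := h.isRenewal_inv.tendsto_div hb
  rw [one_mul] at this
  refine this.congr fun n => ?_
  exact mul_div_mul_right _ _ (pow_ne_zero n (inv_ne_zero h.r_pos.ne'))

theorem one_sub_pos (h : IsArAutocov l r s b ρ) : 0 < 1 - ∑' n, arCoeff l b n * (r⁻¹) ^ n := by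
  linarith [h.lt_half]

theorem one_sub_pos' (h : IsArAutocov l r s b ρ) : 0 < 1 - ∑' n, arCoeff l b n * r ^ n := by
  simpa using (h.isRenewal h.r_pos.le h.r_lt_one.le).one_sub_pos

theorem subexp_resolvent (h : IsArAutocov l r s b ρ)
    (hb : Subexp fun n => arCoeff l b n * (r⁻¹) ^ n) :
    Subexp fun n => resolvent l b n * (r⁻¹) ^ n := by
  have := h.isRenewal_inv.tendsto_div hb
  rw [one_mul] at this
  exact hb.of_div (by have := h.one_sub_pos; positivity) this

theorem tendsto_div_resolvent (h : IsArAutocov l r s b ρ)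
    (hb : Subexp fun n => arCoeff l b n * (r⁻¹) ^ n) :
    Tendsto (fun n => ρ n / resolvent l b n) atTop
      (𝓝 (s * (1 / (1 - ∑' n, arCoeff l b n * r ^ n)))) := by
  obtain ⟨hpos, hratio⟩ := ratio_of_subexp h.r_pos (h.subexp_resolvent hb)
  have h1 := tendsto_tsum_forward h.r_pos h.r_lt_one hpos hratio h.resolvent_nonneg
    h.summable_resolvent
  have h2 := (h.isRenewal h.r_pos.le h.r_lt_one.le).tsum_eq_div
  rw [one_mul] at h2
  rw [h2] at h1
  refine (h1.const_mul s).congr fun n => ?_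
  rw [h.eq_tsum n, mul_div_assoc]

theorem tendsto_div_arCoeff (h : IsArAutocov l r s b ρ)
    (hb : Subexp fun n => arCoeff l b n * (r⁻¹) ^ n) :
    Tendsto (fun n => ρ n / arCoeff l b n) atTop
      (𝓝 (s * (1 / (1 - ∑' n, arCoeff l b n * r ^ n)) *
        (1 / (1 - ∑' n, arCoeff l b n * (r⁻¹) ^ n) ^ 2))) := by
  refine ((h.tendsto_div_resolvent hb).mul (h.tendsto_resolvent_div hb)).congr' ?_
  filter_upwards [(ratio_of_subexp h.r_pos (h.subexp_resolvent hb)).1] with n hn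
  rw [div_mul_div_cancel₀ hn.ne']

theorem subexp_autocov (h : IsArAutocov l r s b ρ)
    (hb : Subexp fun n => arCoeff l b n * (r⁻¹) ^ n) : Subexp fun n => ρ n * (r⁻¹) ^ n := by
  refine (h.subexp_resolvent hb).of_div (c := s * (1 / (1 - ∑' n, arCoeff l b n * r ^ n))) ?_ ?_
  · have := h.one_sub_pos'
    have := h.s_pos
    positivity
  · refine (h.tendsto_div_resolvent hb).congr fun n => ?_
    exact (mul_div_mul_right _ _ (pow_ne_zero n (inv_ne_zero h.r_pos.ne'))).symm

theorem autocov_pos (h : IsArAutocov l r s b ρ)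
    (hb : Subexp fun n => arCoeff l b n * (r⁻¹) ^ n) (n : ℕ) : 0 < ρ n := by
  rw [h.eq_tsum n]
  obtain ⟨N, hN⟩ := eventually_atTop.1 (ratio_of_subexp h.r_pos (h.subexp_resolvent hb)).1
  refine mul_pos h.s_pos ((h.summable_resolvent_mul n).tsum_pos
    (fun j => mul_nonneg (h.resolvent_nonneg _) (h.resolvent_nonneg _)) N
    (mul_pos (hN N le_rfl) (hN _ (by omega))))

theorem subexp_arCoeff (h : IsArAutocov l r s b ρ) (hρ : Subexp fun n => ρ n * (r⁻¹) ^ n) :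
    Subexp fun n => arCoeff l b n * (r⁻¹) ^ n := by
  have hx : ∀ n, (r⁻¹) ^ n ≠ 0 := fun n => pow_ne_zero n (inv_ne_zero h.r_pos.ne')
  obtain ⟨hpos, hratio⟩ := ratio_of_subexp h.r_pos hρ
  have h1 := tendsto_tsum_forward h.r_pos h.r_lt_one hpos hratio h.nonneg h.summable_arCoeff
  have h2 : Tendsto (fun n => resolvent l b n / ρ n) atTop
      (𝓝 ((1 - ∑' n, arCoeff l b n * r ^ n) / s)) := by
    refine ((h1.const_sub 1).div_const s).congr' ?_
    filter_upwards [hpos] with n hn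
    have hs := h.s_pos.ne'
    have hn' := hn.ne'
    field_simp
    linear_combination h.eqn n
  have hz : Subexp fun n => (resolvent l b n - if n = 0 then 1 else 0) * (r⁻¹) ^ n := by
    refine hρ.of_div (div_pos h.one_sub_pos' h.s_pos) (h2.congr' ?_)
    filter_upwards [eventually_ge_atTop 1] with n hn
    rw [if_neg (by omega), sub_zero, mul_div_mul_right _ _ (hx n)]
  have hzs : Summable fun n => resolvent l b n * (r⁻¹) ^ n := h.isRenewal_inv.summable_abs.of_abs
  have hsum : HasSum (fun n => (resolvent l b n - if n = 0 then 1 else 0) * (r⁻¹) ^ n)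
      (1 / (1 - ∑' n, arCoeff l b n * (r⁻¹) ^ n) - 1) := by
    have := h.isRenewal_inv.tsum_eq_div
    rw [one_mul] at this
    rw [← this]
    refine (hzs.hasSum.sub (hasSum_ite_eq 0 (1 : ℝ))).congr_fun fun n => ?_
    split_ifs with hn
    · subst hn; simp
    · ring
  have hren : IsRenewal (-1) (fun n => (resolvent l b n - if n = 0 then 1 else 0) * (r⁻¹) ^ n)
      (fun n => ((if n = 0 then 1 else 0) - arCoeff l b n) * (r⁻¹) ^ n) := by
    refine ⟨by simp, by simp [resolvent_zero], fun n => ?_, hsum.summable, ?_,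
      eqn_weighted _ (arCoeff_eqn l b)⟩
    · refine mul_nonneg ?_ (pow_nonneg (inv_nonneg.2 h.r_pos.le) n)
      split_ifs with hn
      · simp [hn, resolvent_zero]
      · simpa using h.resolvent_nonneg n
    · rw [hsum.tsum_eq, sub_lt_iff_lt_add, div_lt_iff₀ h.one_sub_pos]
      linarith [h.lt_half]
  have h3 := (hren.tendsto_div hz).neg
  refine hz.of_div ?_ (h3.congr' ?_)
  · rw [neg_div, neg_neg]
    have := hren.one_sub_pos
    positivity
  · filter_upwards [eventually_ge_atTop 1] with n hn
    rw [if_neg (by omega), ← neg_div]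
    ring

end IsArAutocov

open scoped ENNReal

/-! ### Solutions depend on the past shocks only -/

/-- The `σ`-algebra generated by the shocks up to time `k`. -/
@[reducible]
def past {Ω : Type*} (ξ : ℤ → Ω → ℝ) (k : ℤ) : MeasurableSpace Ω :=
  ⨆ i ∈ Set.Iic k, MeasurableSpace.comap (ξ i) inferInstance

/-- Picard iterates, started at zero, of the ARCH(`∞`) equations. -/
noncomputable def iterApprox {Ω : Type*} (a : ℝ) (b : ℕ → ℝ) (ξ : ℤ → Ω → ℝ) :
    ℕ → ℤ → Ω → ℝ
  | 0, _, _ => 0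
  | n + 1, k, ω => vol a b (iterApprox a b ξ n) k ω * ξ k ω

/-- Iterates of the homogeneous ARCH(`∞`) operator, started at `r ^ k`. -/
noncomputable def iterBound {Ω : Type*} (b : ℕ → ℝ) (ξ : ℤ → Ω → ℝ) (r : ℝ) :
    ℕ → ℤ → Ω → ℝ≥0∞
  | 0, k, _ => ENNReal.ofReal (r ^ k)
  | n + 1, k, ω => ‖ξ k ω‖ₑ * ∑' j : ℕ, ‖b (j + 1)‖ₑ * iterBound b ξ r n (k - ((j : ℤ) + 1)) ω

section

variable {Ω : Type*} {mΩ : MeasurableSpace Ω} {μ : Measure Ω} {a r : ℝ} {b : ℕ → ℝ}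
  {ξ X : ℤ → Ω → ℝ}

theorem past_le (hξ : ∀ k, Measurable (ξ k)) (k : ℤ) : past ξ k ≤ mΩ :=
  iSup₂_le fun i _ => (hξ i).comap_le

theorem past_mono (ξ : ℤ → Ω → ℝ) {i k : ℤ} (h : i ≤ k) : past ξ i ≤ past ξ k :=
  biSup_mono fun _ hj => le_trans (Set.mem_Iic.1 hj) h

theorem measurable_past (ξ : ℤ → Ω → ℝ) (k : ℤ) : Measurable[past ξ k] (ξ k) :=
  measurable_iff_comap_le.2 (le_iSup₂_of_le k Set.self_mem_Iic le_rfl)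

theorem IsShock.indep_past (hξ : IsShock ξ μ) (k : ℤ) :
    Indep (MeasurableSpace.comap (ξ k) inferInstance) (past ξ (k - 1)) μ := by
  have h := indep_iSup_of_disjoint (S := {k}) (T := Set.Iic (k - 1))
    (fun i => (hξ.measurable i).comap_le) hξ.indep.iIndep (by simp)
  simpa [past] using h

theorem measurable_vol_past {V : ℤ → Ω → ℝ} (hV : ∀ k, Measurable[past ξ k] (V k)) (k : ℤ) :
    Measurable[past ξ (k - 1)] (vol a b V k) := by
  refine Measurable.const_add ?_ a
  let := past ξ (k - 1)
  refine Measurable.tsum fun j => ?_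
  refine Measurable.const_mul ?_ (b (j + 1))
  exact (hV _).mono (past_mono ξ (by omega)) le_rfl

theorem measurable_iterApprox (a : ℝ) (b : ℕ → ℝ) (ξ : ℤ → Ω → ℝ) (n : ℕ) (k : ℤ) :
    Measurable[past ξ k] (iterApprox a b ξ n k) := by
  induction n generalizing k with
  | zero => exact measurable_const
  | succ n ih =>
    exact Measurable.mul ((measurable_vol_past ih k).mono (past_mono ξ (Int.sub_le_self k
      zero_le_one)) le_rfl) (measurable_past ξ k)

theorem measurable_tsum_iterBound {S : ℤ → Ω → ℝ≥0∞} (hS : ∀ k, Measurable[past ξ k] (S k))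
    (k : ℤ) :
    Measurable[past ξ (k - 1)] fun ω => ∑' j : ℕ, ‖b (j + 1)‖ₑ * S (k - ((j : ℤ) + 1)) ω := by
  let := past ξ (k - 1)
  refine Measurable.tsum fun j => ?_
  refine Measurable.const_mul ?_ _
  exact (hS _).mono (past_mono ξ (by omega)) le_rfl

theorem measurable_iterBound (b : ℕ → ℝ) (ξ : ℤ → Ω → ℝ) (r : ℝ) (n : ℕ) (k : ℤ) :
    Measurable[past ξ k] (iterBound b ξ r n k) := by
  induction n generalizing k with
  | zero => exact measurable_const
  | succ n ih =>
    exact Measurable.mul (measurable_enorm.comp (measurable_past ξ k))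
      ((measurable_tsum_iterBound ih k).mono (past_mono ξ (Int.sub_le_self k zero_le_one)) le_rfl)

theorem lintegral_tsum_iterBound (hξ : IsShock ξ μ) (n : ℕ) (k : ℤ) :
    ∫⁻ ω, ∑' j : ℕ, ‖b (j + 1)‖ₑ * iterBound b ξ r n (k - ((j : ℤ) + 1)) ω ∂μ =
      ∑' j : ℕ, ‖b (j + 1)‖ₑ * ∫⁻ ω, iterBound b ξ r n (k - ((j : ℤ) + 1)) ω ∂μ := by
  have hm : ∀ i, Measurable (iterBound b ξ r n i) := fun i =>
    (measurable_iterBound b ξ r n i).mono (past_le hξ.measurable i) le_rfl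
  rw [lintegral_tsum fun j => ((hm _).const_mul _).aemeasurable]
  exact tsum_congr fun j => lintegral_const_mul _ (hm _)

theorem ofReal_zpow_sub (hr : 0 < r) (k : ℤ) (j : ℕ) :
    ENNReal.ofReal (r ^ (k - ((j : ℤ) + 1))) =
      ENNReal.ofReal (r ^ k) * ENNReal.ofReal ((r ^ (j + 1))⁻¹) := by
  rw [← ENNReal.ofReal_mul (by positivity), zpow_sub₀ hr.ne']
  norm_cast

theorem lintegral_iterBound (hξ : IsShock ξ μ) (hr : 0 < r) [IsProbabilityMeasure μ]
    (n : ℕ) (k : ℤ) :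
    ∫⁻ ω, iterBound b ξ r n k ω ∂μ = ENNReal.ofReal (r ^ k) *
      ((∫⁻ ω, ‖ξ 0 ω‖ₑ ∂μ) * ∑' j : ℕ, ‖b (j + 1)‖ₑ * ENNReal.ofReal ((r ^ (j + 1))⁻¹)) ^ n := by
  set Θ := (∫⁻ ω, ‖ξ 0 ω‖ₑ ∂μ) * ∑' j : ℕ, ‖b (j + 1)‖ₑ * ENNReal.ofReal ((r ^ (j + 1))⁻¹)
    with hΘ
  induction n generalizing k with
  | zero => simp [iterBound]
  | succ n ih =>
    simp only [iterBound]
    have h1 := lintegral_mul_eq_lintegral_mul_lintegral_of_independent_measurableSpace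
      (hξ.measurable k).comap_le (past_le hξ.measurable (k - 1)) (hξ.indep_past k)
      (f := fun ω => ‖ξ k ω‖ₑ) (measurable_enorm.comp (comap_measurable (ξ k)))
      (measurable_tsum_iterBound (b := b) (measurable_iterBound b ξ r n) k)
    have h3 : ∫⁻ ω, ‖ξ k ω‖ₑ ∂μ = ∫⁻ ω, ‖ξ 0 ω‖ₑ ∂μ :=
      ((hξ.ident k).comp (u := fun x : ℝ => ‖x‖ₑ) measurable_enorm).lintegral_eq
    rw [h1, lintegral_tsum_iterBound hξ, h3]
    simp only [ih, ofReal_zpow_sub hr]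
    have h2 : ∀ j : ℕ, ‖b (j + 1)‖ₑ *
        (ENNReal.ofReal (r ^ k) * ENNReal.ofReal ((r ^ (j + 1))⁻¹) * Θ ^ n) =
        ENNReal.ofReal (r ^ k) * Θ ^ n * (‖b (j + 1)‖ₑ * ENNReal.ofReal ((r ^ (j + 1))⁻¹)) :=
      fun j => by ring
    rw [tsum_congr h2, ENNReal.tsum_mul_left, pow_succ]
    nth_rewrite 3 [hΘ]
    ring

theorem ae_growth (hX : ∀ k, Measurable (X k)) (hr0 : 0 < r) (hr1 : r < 1) {B : ℝ≥0∞}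
    (hB : B ≠ ∞) (hXB : ∀ k, ∫⁻ ω, ‖X k ω‖ₑ ∂μ ≤ B) (K : ℤ) :
    ∀ᵐ ω ∂μ, ∃ C : ℝ≥0∞, C ≠ ∞ ∧ ∀ k ≤ K, ‖X k ω‖ₑ ≤ C * ENNReal.ofReal (r ^ k) := by
  have hint : ∫⁻ ω, ∑' m : ℕ, ‖X (K - m) ω‖ₑ * ENNReal.ofReal (r ^ m) ∂μ ≠ ∞ := by
    rw [lintegral_tsum fun m => ((hX _).enorm.mul_const _).aemeasurable]
    have h1 : ∀ m : ℕ, ∫⁻ ω, ‖X (K - m) ω‖ₑ * ENNReal.ofReal (r ^ m) ∂μ ≤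
        B * ENNReal.ofReal r ^ m := fun m => by
      rw [lintegral_mul_const _ (hX _).enorm, ← ENNReal.ofReal_pow hr0.le]
      gcongr
      exact hXB _
    refine ne_top_of_le_ne_top ?_ (ENNReal.tsum_le_tsum h1)
    rw [ENNReal.tsum_mul_left, ENNReal.tsum_geometric]
    refine ENNReal.mul_ne_top hB (ENNReal.inv_ne_top.2 (tsub_pos_of_lt ?_).ne')
    rwa [ENNReal.ofReal_lt_one]
  have hmeas : Measurable fun ω => ∑' m : ℕ, ‖X (K - m) ω‖ₑ * ENNReal.ofReal (r ^ m) :=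
    Measurable.tsum fun m => (hX _).enorm.mul_const _
  filter_upwards [ae_lt_top hmeas hint] with ω hω
  refine ⟨_, ENNReal.mul_ne_top hω.ne (ENNReal.ofReal_ne_top (r := r ^ (-K))), fun k hk => ?_⟩
  obtain ⟨m, hm⟩ := Int.eq_ofNat_of_zero_le (sub_nonneg.2 hk)
  have hkm : k = K - m := by omega
  have h1 : ENNReal.ofReal (r ^ m) * (ENNReal.ofReal (r ^ (-K)) * ENNReal.ofReal (r ^ k)) = 1 := by
    rw [← ENNReal.ofReal_mul (by positivity), ← ENNReal.ofReal_mul (by positivity), hkm,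
      ← zpow_natCast, ← zpow_add₀ hr0.ne', ← zpow_add₀ hr0.ne',
      show (m : ℤ) + (-K + (K - m)) = 0 by ring]
    simp
  calc ‖X k ω‖ₑ = ‖X (K - m) ω‖ₑ * ENNReal.ofReal (r ^ m) *
        (ENNReal.ofReal (r ^ (-K)) * ENNReal.ofReal (r ^ k)) := by
        rw [mul_assoc, h1, mul_one, hkm]
    _ ≤ (∑' m : ℕ, ‖X (K - m) ω‖ₑ * ENNReal.ofReal (r ^ m)) *
        (ENNReal.ofReal (r ^ (-K)) * ENNReal.ofReal (r ^ k)) := by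
        gcongr
        exact ENNReal.le_tsum m
    _ = _ := by rw [mul_assoc]

/-- The contraction hypothesis: `E[ξ(0)] ∑ b(j) r^{-j} < 1`. -/
def IsContractive (b : ℕ → ℝ) (ξ : ℤ → Ω → ℝ) (r : ℝ) (μ : Measure Ω) : Prop :=
  (∫⁻ ω, ‖ξ 0 ω‖ₑ ∂μ) * ∑' j : ℕ, ‖b (j + 1)‖ₑ * ENNReal.ofReal ((r ^ (j + 1))⁻¹) < 1

theorem ae_tendsto_iterBound [IsProbabilityMeasure μ] (hξ : IsShock ξ μ) (hr : 0 < r)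
    (hΘ : IsContractive b ξ r μ) (k : ℤ) :
    ∀ᵐ ω ∂μ, Tendsto (fun n => iterBound b ξ r n k ω) atTop (𝓝 0) := by
  have hm : ∀ n, Measurable (iterBound b ξ r n k) := fun n =>
    (measurable_iterBound b ξ r n k).mono (past_le hξ.measurable k) le_rfl
  have hint : ∫⁻ ω, ∑' n : ℕ, iterBound b ξ r n k ω ∂μ ≠ ∞ := by
    rw [lintegral_tsum fun n => (hm n).aemeasurable,
      tsum_congr fun n => lintegral_iterBound hξ hr n k, ENNReal.tsum_mul_left,
      ENNReal.tsum_geometric]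
    exact ENNReal.mul_ne_top ENNReal.ofReal_ne_top (ENNReal.inv_ne_top.2 (tsub_pos_of_lt hΘ).ne')
  filter_upwards [ae_lt_top (Measurable.tsum hm) hint] with ω hω
  exact ENNReal.tendsto_atTop_zero_of_tsum_ne_top hω.ne

theorem ae_tsum_iterBound_lt_top [IsProbabilityMeasure μ] (hξ : IsShock ξ μ) (hr : 0 < r)
    (hb : ∑' j : ℕ, ‖b (j + 1)‖ₑ * ENNReal.ofReal ((r ^ (j + 1))⁻¹) ≠ ∞)
    (hΘ : IsContractive b ξ r μ) (n : ℕ) (k : ℤ) :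
    ∀ᵐ ω ∂μ, ∑' j : ℕ, ‖b (j + 1)‖ₑ * iterBound b ξ r n (k - ((j : ℤ) + 1)) ω < ∞ := by
  refine ae_lt_top ((measurable_tsum_iterBound (measurable_iterBound b ξ r n) k).mono
    (past_le hξ.measurable _) le_rfl) ?_
  rw [lintegral_tsum_iterBound hξ]
  simp only [lintegral_iterBound hξ hr, ofReal_zpow_sub hr]
  have h2 : ∀ (j : ℕ) (c d : ℝ≥0∞), ‖b (j + 1)‖ₑ *
      (c * ENNReal.ofReal ((r ^ (j + 1))⁻¹) * d) =
      c * d * (‖b (j + 1)‖ₑ * ENNReal.ofReal ((r ^ (j + 1))⁻¹)) :=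
    fun j c d => by ring
  rw [tsum_congr fun j => h2 j _ _, ENNReal.tsum_mul_left]
  exact ENNReal.mul_ne_top (ENNReal.mul_ne_top ENNReal.ofReal_ne_top
    (ENNReal.pow_ne_top (hΘ.trans ENNReal.one_lt_top).ne)) hb

theorem enorm_sub_iterApprox_le {ω : Ω} {K : ℤ} {C : ℝ≥0∞} (hC : C ≠ ∞)
    (hXC : ∀ k ≤ K, ‖X k ω‖ₑ ≤ C * ENNReal.ofReal (r ^ k))
    (hs : ∀ k, Summable fun j : ℕ => b (j + 1) * X (k - ((j : ℤ) + 1)) ω)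
    (heq : ∀ k, X k ω = vol a b X k ω * ξ k ω)
    (hS : ∀ n k, ∑' j : ℕ, ‖b (j + 1)‖ₑ * iterBound b ξ r n (k - ((j : ℤ) + 1)) ω < ∞)
    (n : ℕ) : ∀ k ≤ K, ‖X k ω - iterApprox a b ξ n k ω‖ₑ ≤ C * iterBound b ξ r n k ω := by
  induction n with
  | zero => simpa [iterApprox, iterBound] using hXC
  | succ n ih =>
    intro k hk
    simp only [iterApprox, iterBound]
    have hle : ∑' j : ℕ, ‖b (j + 1) * (X (k - ((j : ℤ) + 1)) ω -
        iterApprox a b ξ n (k - ((j : ℤ) + 1)) ω)‖ₑ ≤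
        C * ∑' j : ℕ, ‖b (j + 1)‖ₑ * iterBound b ξ r n (k - ((j : ℤ) + 1)) ω := by
      rw [← ENNReal.tsum_mul_left]
      refine ENNReal.tsum_le_tsum fun j => ?_
      rw [enorm_mul, mul_left_comm]
      gcongr
      exact ih _ (by omega)
    have hsd : Summable fun j : ℕ => b (j + 1) * (X (k - ((j : ℤ) + 1)) ω -
        iterApprox a b ξ n (k - ((j : ℤ) + 1)) ω) :=
      (tsum_enorm_ne_top_iff_summable_norm.1
        (ne_top_of_le_ne_top (ENNReal.mul_ne_top hC (hS n k).ne) hle)).of_norm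
    have hsV : Summable fun j : ℕ => b (j + 1) * iterApprox a b ξ n (k - ((j : ℤ) + 1)) ω := by
      refine ((hs k).sub hsd).congr fun j => ?_
      ring
    have hvol : vol a b X k ω - vol a b (iterApprox a b ξ n) k ω =
        ∑' j : ℕ, b (j + 1) * (X (k - ((j : ℤ) + 1)) ω -
          iterApprox a b ξ n (k - ((j : ℤ) + 1)) ω) := by
      simp only [vol, mul_sub]
      rw [(hs k).tsum_sub hsV]
      ring
    rw [heq k, ← sub_mul, hvol, enorm_mul, mul_comm, mul_left_comm]
    gcongr
    exact enorm_tsum_le_tsum_enorm.trans hle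

/-- A solution of at most moderate growth is a function of the past shocks. -/
theorem IsArchSolution.aestronglyMeasurable_past [IsProbabilityMeasure μ] (hξ : IsShock ξ μ)
    (hX : IsArchSolution a b ξ X μ) (hr0 : 0 < r) (hr1 : r < 1)
    (hb : ∑' j : ℕ, ‖b (j + 1)‖ₑ * ENNReal.ofReal ((r ^ (j + 1))⁻¹) ≠ ∞)
    (hΘ : IsContractive b ξ r μ) {B : ℝ≥0∞}
    (hB : B ≠ ∞) (hXB : ∀ k, ∫⁻ ω, ‖X k ω‖ₑ ∂μ ≤ B) (k : ℤ) :
    AEStronglyMeasurable[past ξ k] (X k) μ := by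
  refine ⟨fun ω => limsup (fun n => iterApprox a b ξ n k ω) atTop, ?_, ?_⟩
  · refine Measurable.stronglyMeasurable ?_
    exact Measurable.limsup fun n => measurable_iterApprox a b ξ n k
  · filter_upwards [ae_growth hX.measurable hr0 hr1 hB hXB k, ae_all_iff.2 hX.summable,
      ae_all_iff.2 hX.eqn, ae_all_iff.2 fun n => ae_all_iff.2 fun i =>
        ae_tsum_iterBound_lt_top hξ hr0 hb hΘ n i, ae_tendsto_iterBound hξ hr0 hΘ k]
      with ω ⟨C, hC, hXC⟩ hs heq hS hlim
    refine (Tendsto.limsup_eq (tendsto_iff_edist_tendsto_0.2 ?_)).symm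
    have h0 : Tendsto (fun n => C * iterBound b ξ r n k ω) atTop (𝓝 0) := by
      simpa using ENNReal.Tendsto.const_mul hlim (Or.inr hC)
    refine tendsto_of_tendsto_of_tendsto_of_le_of_le tendsto_const_nhds h0
      (fun _ => zero_le) fun n => ?_
    rw [edist_comm, edist_eq_enorm_sub]
    exact enorm_sub_iterApprox_le hC hXC hs heq hS n k le_rfl

theorem aestronglyMeasurable_vol_past (hX : ∀ k, AEStronglyMeasurable[past ξ k] (X k) μ) (k : ℤ) :
    AEStronglyMeasurable[past ξ (k - 1)] (vol a b X k) μ := by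
  choose Y hY hXY using hX
  refine ⟨vol a b Y k, ?_, ?_⟩
  · refine Measurable.stronglyMeasurable ?_
    exact measurable_vol_past (fun i => (hY i).measurable) k
  · filter_upwards [ae_all_iff.2 hXY] with ω hω
    simp only [vol, hω]

theorem IsShock.indepFun_comp (hξ : IsShock ξ μ) {k : ℤ} {U : Ω → ℝ} {f : ℝ → ℝ}
    (hf : Measurable f) (hU : AEStronglyMeasurable[past ξ (k - 1)] U μ) :
    (fun ω => f (ξ k ω)) ⟂ᵢ[μ] U := by
  obtain ⟨V, hV, hUV⟩ := hU
  refine IndepFun.congr ?_ EventuallyEq.rfl hUV.symm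
  rw [IndepFun_iff_Indep]
  refine indep_of_indep_of_le (hξ.indep_past k) ?_ (measurable_iff_comap_le.1 hV.measurable)
  exact measurable_iff_comap_le.1 (hf.comp (comap_measurable (ξ k)))

end

/-! ### Second moments -/

/-- A square integrable stationary solution that is a function of the past shocks. -/
structure IsCausalSolution {Ω : Type*} [MeasurableSpace Ω] (l a : ℝ) (b : ℕ → ℝ)
    (ξ X : ℤ → Ω → ℝ) (ρ : ℤ → ℝ) (μ : Measure Ω) : Prop where
  a_pos : 0 < a
  nonneg : ∀ j, 1 ≤ j → 0 ≤ b j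
  summable : Summable fun j : ℕ => b (j + 1)
  shock : IsShock ξ μ
  memLp : MemLp (ξ 0) 2 μ
  mean_eq : l = ∫ ω, ξ 0 ω ∂μ
  mean_pos : 0 < l
  mul_lt_one : l * ∑' j : ℕ, b (j + 1) < 1
  var_pos : 0 < Var[ξ 0; μ]
  sol : IsArchSolution a b ξ X μ
  stat : IsWeaklyStationary X ρ μ
  causal : ∀ k, AEStronglyMeasurable[past ξ k] (X k) μ

namespace IsWeaklyStationary

variable {Ω : Type*} [MeasurableSpace Ω] {μ : Measure Ω} [IsProbabilityMeasure μ]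
  {X : ℤ → Ω → ℝ} {ρ : ℤ → ℝ}

theorem integral_mul (h : IsWeaklyStationary X ρ μ) (i n : ℤ) :
    ∫ ω, X i ω * X n ω ∂μ = ρ (n - i) + (∫ ω, X 0 ω ∂μ) ^ 2 := by
  have h1 := h.cov i (n - i)
  rw [show i + (n - i) = n by ring, covariance_eq_sub (h.memLp i) (h.memLp n), h.mean i,
    h.mean n] at h1
  simp only [Pi.mul_apply] at h1
  linear_combination h1

theorem integral_sq (h : IsWeaklyStationary X ρ μ) (i : ℤ) :
    ∫ ω, X i ω ^ 2 ∂μ = ρ 0 + (∫ ω, X 0 ω ∂μ) ^ 2 := by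
  have := h.integral_mul i i
  rw [sub_self] at this
  simpa only [sq] using this

theorem abs_integral_mul_le {U V : Ω → ℝ} (hU : MemLp U 2 μ) (hV : MemLp V 2 μ) :
    ∫ ω, |U ω * V ω| ∂μ ≤ ∫ ω, U ω ^ 2 ∂μ + ∫ ω, V ω ^ 2 ∂μ := by
  rw [← integral_add hU.integrable_sq hV.integrable_sq]
  refine integral_mono (hU.integrable_mul hV).abs (hU.integrable_sq.add hV.integrable_sq)
    fun ω => ?_
  simp only [abs_mul]
  rw [← sq_abs (U ω), ← sq_abs (V ω)]
  nlinarith [sq_nonneg (|U ω| - |V ω|), sq_nonneg (|U ω| + |V ω|)]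

theorem abs_le (h : IsWeaklyStationary X ρ μ) (n : ℤ) :
    |ρ n| ≤ 2 * (ρ 0 + (∫ ω, X 0 ω ∂μ) ^ 2) + (∫ ω, X 0 ω ∂μ) ^ 2 := by
  have h1 := h.integral_mul 0 n
  rw [sub_zero] at h1
  have h2 := (abs_integral_le_integral_abs (f := fun ω => X 0 ω * X n ω)).trans
    (abs_integral_mul_le (h.memLp 0) (h.memLp n))
  rw [h.integral_sq, h.integral_sq, h1] at h2
  have h3 := _root_.abs_le.1 h2
  rw [_root_.abs_le]
  constructor <;> nlinarith [sq_nonneg (∫ ω, X 0 ω ∂μ)]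

theorem lintegral_enorm_le (h : IsWeaklyStationary X ρ μ) (k : ℤ) :
    ∫⁻ ω, ‖X k ω‖ₑ ∂μ ≤ ENNReal.ofReal (1 + (ρ 0 + (∫ ω, X 0 ω ∂μ) ^ 2)) := by
  have hi : Integrable (X k) μ := (h.memLp k).integrable one_le_two
  rw [← ofReal_integral_norm_eq_lintegral_enorm hi, ← h.integral_sq k]
  refine ENNReal.ofReal_le_ofReal ?_
  have h1 : ∫ ω, (1 + X k ω ^ 2) ∂μ = 1 + ∫ ω, X k ω ^ 2 ∂μ := by
    rw [integral_add (integrable_const _) (h.memLp k).integrable_sq]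
    simp
  rw [← h1]
  refine integral_mono hi.norm ((integrable_const _).add (h.memLp k).integrable_sq) fun ω => ?_
  simp only [Real.norm_eq_abs]
  rw [← sq_abs (X k ω)]
  nlinarith [sq_nonneg (|X k ω| - 1)]

end IsWeaklyStationary

namespace IsCausalSolution

variable {Ω : Type*} [MeasurableSpace Ω] {μ : Measure Ω} [IsProbabilityMeasure μ]
  {l a : ℝ} {b : ℕ → ℝ} {ξ X : ℤ → Ω → ℝ} {ρ : ℤ → ℝ}

theorem vol_past (h : IsCausalSolution l a b ξ X ρ μ) (k : ℤ) :
    AEStronglyMeasurable[past ξ (k - 1)] (vol a b X k) μ :=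
  aestronglyMeasurable_vol_past h.causal k

theorem vol_meas (h : IsCausalSolution l a b ξ X ρ μ) (k : ℤ) :
    AEStronglyMeasurable (vol a b X k) μ :=
  (h.vol_past k).mono (past_le h.shock.measurable _)

theorem integral_shock_comp (h : IsCausalSolution l a b ξ X ρ μ) {f : ℝ → ℝ} (hf : Measurable f)
    (k : ℤ) : ∫ ω, f (ξ k ω) ∂μ = ∫ ω, f (ξ 0 ω) ∂μ :=
  ((h.shock.ident k).comp hf).integral_eq

theorem integral_shock_mul (h : IsCausalSolution l a b ξ X ρ μ) {f : ℝ → ℝ} (hf : Measurable f)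
    {k : ℤ} {U : Ω → ℝ} (hU : AEStronglyMeasurable[past ξ (k - 1)] U μ) :
    ∫ ω, f (ξ k ω) * U ω ∂μ = (∫ ω, f (ξ 0 ω) ∂μ) * ∫ ω, U ω ∂μ := by
  rw [← h.integral_shock_comp hf k]
  exact (h.shock.indepFun_comp hf hU).integral_mul_eq_mul_integral
    (hf.comp (h.shock.measurable k)).aestronglyMeasurable
    (hU.mono (past_le h.shock.measurable _))

theorem integral_sub_mean (h : IsCausalSolution l a b ξ X ρ μ) : ∫ ω, (ξ 0 ω - l) ∂μ = 0 := by
  rw [integral_sub (h.memLp.integrable one_le_two) (integrable_const _), ← h.mean_eq]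
  simp

theorem integral_sub_mean_sq (h : IsCausalSolution l a b ξ X ρ μ) :
    ∫ ω, (ξ 0 ω - l) ^ 2 ∂μ = Var[ξ 0; μ] := by
  rw [variance_eq_integral (h.shock.measurable 0).aemeasurable, h.mean_eq]

theorem vol_memLp (h : IsCausalSolution l a b ξ X ρ μ) (k : ℤ) : MemLp (vol a b X k) 2 μ := by
  rw [memLp_two_iff_integrable_sq (h.vol_meas k)]
  have hind : (fun ω => ξ k ω ^ 2) ⟂ᵢ[μ] fun ω => vol a b X k ω ^ 2 :=
    (h.shock.indepFun_comp (f := fun x => x) measurable_id (h.vol_past k)).comp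
      (φ := fun x : ℝ => x ^ 2) (ψ := fun x : ℝ => x ^ 2) (by fun_prop) (by fun_prop)
  refine hind.integrable_right_of_integrable_op (fun x y : ℝ => x * y) 1 one_ne_zero
    (fun x y => by simp [enorm_mul]) ?_
    ((h.shock.measurable k).pow_const 2).aestronglyMeasurable ((h.vol_meas k).pow 2) ?_
  · refine (h.stat.memLp k).integrable_sq.congr ?_
    filter_upwards [h.sol.eqn k] with ω hω
    rw [hω]
    ring
  · intro h0
    have h1 : ξ k =ᵐ[μ] 0 := by
      filter_upwards [h0] with ω hω
      exact pow_eq_zero_iff two_ne_zero |>.1 hω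
    have h2 : l = 0 := by
      rw [h.mean_eq, ← (h.shock.ident k).integral_eq]
      exact integral_eq_zero_of_ae h1
    exact h.mean_pos.ne' h2

theorem innov_eq (h : IsCausalSolution l a b ξ X ρ μ) (k : ℤ) :
    innov l a b X k =ᵐ[μ] fun ω => (ξ k ω - l) * vol a b X k ω := by
  filter_upwards [h.sol.eqn k] with ω hω
  rw [innov, hω]
  ring

theorem innov_memLp (h : IsCausalSolution l a b ξ X ρ μ) (k : ℤ) :
    MemLp (innov l a b X k) 2 μ :=
  (h.stat.memLp k).sub ((h.vol_memLp k).const_mul l)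

/-- The innovation is orthogonal to the past. -/
theorem integral_innov_mul_past (h : IsCausalSolution l a b ξ X ρ μ) {k : ℤ} {U : Ω → ℝ}
    (hU : AEStronglyMeasurable[past ξ (k - 1)] U μ) : ∫ ω, innov l a b X k ω * U ω ∂μ = 0 := by
  have h1 : ∫ ω, innov l a b X k ω * U ω ∂μ =
      ∫ ω, (ξ k ω - l) * (vol a b X k ω * U ω) ∂μ := by
    refine integral_congr_ae ?_
    filter_upwards [h.innov_eq k] with ω hω
    rw [hω]
    ring
  have h2 := h.integral_shock_mul (f := fun x => x - l) (by fun_prop) ((h.vol_past k).mul hU)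
  rw [h.integral_sub_mean, zero_mul] at h2
  exact h1.trans h2

theorem innov_past (h : IsCausalSolution l a b ξ X ρ μ) {i k : ℤ} (hik : i ≤ k) :
    AEStronglyMeasurable[past ξ k] (innov l a b X i) μ :=
  (((h.causal i).mono (past_mono ξ hik)).sub
    (((h.vol_past i).mono (past_mono ξ (by omega))).const_mul l))

theorem hasSum_integral_mul (h : IsCausalSolution l a b ξ X ρ μ) (k : ℤ) {Y : Ω → ℝ}
    (hY : MemLp Y 2 μ) :
    HasSum (fun j : ℕ => b (j + 1) * ∫ ω, X (k - ((j : ℤ) + 1)) ω * Y ω ∂μ)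
      (∫ ω, (vol a b X k ω - a) * Y ω ∂μ) := by
  have hint : ∀ j : ℕ, Integrable (fun ω => b (j + 1) * (X (k - ((j : ℤ) + 1)) ω * Y ω)) μ :=
    fun j => ((h.stat.memLp _).integrable_mul hY).const_mul _
  have := hasSum_integral_of_summable_integral_norm hint (by
    refine (h.summable.mul_right
      (ρ 0 + (∫ ω, X 0 ω ∂μ) ^ 2 + ∫ ω, Y ω ^ 2 ∂μ)).of_nonneg_of_le
      (fun j => integral_nonneg fun ω => norm_nonneg _) fun j => ?_
    simp only [norm_mul (b (j + 1)), Real.norm_of_nonneg (h.nonneg (j + 1) (by omega))]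
    rw [integral_const_mul, ← h.stat.integral_sq (k - ((j : ℤ) + 1))]
    exact mul_le_mul_of_nonneg_left
      (IsWeaklyStationary.abs_integral_mul_le (h.stat.memLp _) hY) (h.nonneg _ (by omega)))
  simp only [integral_const_mul] at this
  convert! this using 1
  refine integral_congr_ae (Eventually.of_forall fun ω => ?_)
  simp only [vol, add_sub_cancel_left, ← mul_assoc]
  rw [tsum_mul_right]

theorem integral_innov_mul (h : IsCausalSolution l a b ξ X ρ μ) (k : ℤ) {Y : Ω → ℝ}
    (hY : MemLp Y 2 μ) :
    ∫ ω, innov l a b X k ω * Y ω ∂μ = ∫ ω, X k ω * Y ω ∂μ -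
      l * (a * ∫ ω, Y ω ∂μ +
        ∑' j : ℕ, b (j + 1) * ∫ ω, X (k - ((j : ℤ) + 1)) ω * Y ω ∂μ) := by
  have hY1 : Integrable (fun ω => a * Y ω) μ := (hY.integrable one_le_two).const_mul a
  have hvY : Integrable (fun ω => (vol a b X k ω - a) * Y ω) μ :=
    ((h.vol_memLp k).sub (memLp_const a)).integrable_mul hY
  have hXY : Integrable (fun ω => X k ω * Y ω) μ := (h.stat.memLp k).integrable_mul hY
  have hlY : Integrable (fun ω => l * (a * Y ω + (vol a b X k ω - a) * Y ω)) μ :=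
    (hY1.add hvY).const_mul l
  rw [(h.hasSum_integral_mul k hY).tsum_eq, ← integral_const_mul, ← integral_add hY1 hvY,
    ← integral_const_mul, ← integral_sub hXY hlY]
  refine integral_congr_ae (Eventually.of_forall fun ω => ?_)
  simp only [innov]
  ring

theorem integral_innov (h : IsCausalSolution l a b ξ X ρ μ) (k : ℤ) :
    ∫ ω, innov l a b X k ω ∂μ = 0 := by
  simpa using h.integral_innov_mul_past (k := k) (U := fun _ => 1) aestronglyMeasurable_const

theorem mean_eqn (h : IsCausalSolution l a b ξ X ρ μ) :
    ∫ ω, X 0 ω ∂μ = l * (a + (∑' j : ℕ, b (j + 1)) * ∫ ω, X 0 ω ∂μ) := by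
  have h1 := h.integral_innov_mul 0 (Y := fun _ => 1) (memLp_const 1)
  simp only [mul_one, h.integral_innov] at h1
  simp only [h.stat.mean (0 - _), tsum_mul_right] at h1
  simp at h1
  linarith

theorem mean_sol_pos (h : IsCausalSolution l a b ξ X ρ μ) : 0 < ∫ ω, X 0 ω ∂μ := by
  have h1 : (∫ ω, X 0 ω ∂μ) * (1 - l * ∑' j : ℕ, b (j + 1)) = l * a := by
    linear_combination h.mean_eqn
  have h2 : 0 < l * a := mul_pos h.mean_pos h.a_pos
  rw [← h1] at h2
  exact (mul_pos_iff_of_pos_right (by linarith [h.mul_lt_one])).1 h2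

theorem integral_innov_sq_pos (h : IsCausalSolution l a b ξ X ρ μ) :
    0 < ∫ ω, innov l a b X 0 ω ^ 2 ∂μ := by
  have h1 : ∫ ω, innov l a b X 0 ω ^ 2 ∂μ = Var[ξ 0; μ] * ∫ ω, vol a b X 0 ω ^ 2 ∂μ := by
    have h2 := h.integral_shock_mul (f := fun x => (x - l) ^ 2) (by fun_prop)
      ((h.vol_past 0).pow 2)
    rw [h.integral_sub_mean_sq] at h2
    refine Eq.trans (integral_congr_ae ?_) h2
    filter_upwards [h.innov_eq 0] with ω hω
    rw [hω, mul_pow]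
    rfl
  rw [h1]
  refine mul_pos h.var_pos (lt_of_le_of_ne (integral_nonneg fun ω => sq_nonneg _) fun h0 => ?_)
  have h3 := (integral_eq_zero_iff_of_nonneg (fun ω => sq_nonneg (vol a b X 0 ω))
    (h.vol_memLp 0).integrable_sq).1 h0.symm
  refine h.mean_sol_pos.ne' (integral_eq_zero_of_ae ?_)
  filter_upwards [h3, h.sol.eqn 0] with ω hω hX
  rw [hX, pow_eq_zero_iff two_ne_zero |>.1 hω, zero_mul]
  rfl

theorem bounded (h : IsCausalSolution l a b ξ X ρ μ) : ∃ C, ∀ n, |ρ n| ≤ C :=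
  ⟨_, h.stat.abs_le⟩

/-- The covariance of `X(n)` and `ν(k)` in terms of the autocovariances. -/
theorem integral_innov_mul_sol (h : IsCausalSolution l a b ξ X ρ μ) (k n : ℤ) :
    ∫ ω, innov l a b X k ω * X n ω ∂μ =
      ρ (n - k) - l * ∑' j : ℕ, b (j + 1) * ρ (n - k + ((j : ℤ) + 1)) := by
  obtain ⟨C, hC⟩ := h.bounded
  have hs : Summable fun j : ℕ => b (j + 1) * ρ (n - k + ((j : ℤ) + 1)) := by
    refine Summable.of_norm_bounded (h.summable.mul_right C) fun j => ?_
    rw [norm_mul, Real.norm_of_nonneg (h.nonneg _ (by omega))]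
    exact mul_le_mul_of_nonneg_left (hC _) (h.nonneg _ (by omega))
  rw [h.integral_innov_mul k (h.stat.memLp n), h.stat.integral_mul, h.stat.mean n]
  have h1 : ∀ j : ℕ, b (j + 1) * ∫ ω, X (k - ((j : ℤ) + 1)) ω * X n ω ∂μ =
      b (j + 1) * ρ (n - k + ((j : ℤ) + 1)) + b (j + 1) * (∫ ω, X 0 ω ∂μ) ^ 2 := fun j => by
    rw [h.stat.integral_mul, show n - (k - ((j : ℤ) + 1)) = n - k + ((j : ℤ) + 1) by ring, mul_add]
  rw [tsum_congr h1, hs.tsum_add (h.summable.mul_right _), tsum_mul_right]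
  linear_combination (∫ ω, X 0 ω ∂μ) * h.mean_eqn

theorem integral_sol_mul_innov_of_neg (h : IsCausalSolution l a b ξ X ρ μ) {k : ℤ} (hk : k < 0) :
    ∫ ω, X k ω * innov l a b X 0 ω ∂μ = 0 := by
  simp only [mul_comm (X _ _)]
  exact h.integral_innov_mul_past ((h.causal k).mono (past_mono ξ (by omega)))

theorem integral_innov_mul_innov (h : IsCausalSolution l a b ξ X ρ μ) (n : ℕ) :
    ∫ ω, innov l a b X n ω * innov l a b X 0 ω ∂μ =
      ∫ ω, X n ω * innov l a b X 0 ω ∂μ - l * ∑ j ∈ Finset.range n,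
        b (j + 1) * ∫ ω, X ((n - (j + 1) : ℕ) : ℤ) ω * innov l a b X 0 ω ∂μ := by
  rw [h.integral_innov_mul n (h.innov_memLp 0), h.integral_innov, mul_zero, zero_add,
    tsum_eq_sum (s := Finset.range n) fun j hj => ?_]
  · congr 2
    refine Finset.sum_congr rfl fun j hj => ?_
    have := Finset.mem_range.1 hj
    rw [show (n : ℤ) - ((j : ℤ) + 1) = ((n - (j + 1) : ℕ) : ℤ) by omega]
  · have : n ≤ j := by simpa using hj
    rw [h.integral_sol_mul_innov_of_neg (by omega), mul_zero]

/-- The covariances of `X(n)` and `ν(0)` are proportional to the resolvent. -/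
theorem integral_sol_mul_innov_eq (h : IsCausalSolution l a b ξ X ρ μ) (n : ℕ) :
    ∫ ω, X n ω * innov l a b X 0 ω ∂μ =
      (∫ ω, innov l a b X 0 ω ^ 2 ∂μ) * resolvent l b n := by
  induction n using Nat.strong_induction_on with
  | _ n ih =>
    have h1 := h.integral_innov_mul_innov n
    have h2 : ∑ j ∈ Finset.range n,
        b (j + 1) * ∫ ω, X ((n - (j + 1) : ℕ) : ℤ) ω * innov l a b X 0 ω ∂μ =
        (∫ ω, innov l a b X 0 ω ^ 2 ∂μ) *
          ∑ j ∈ Finset.range n, b (j + 1) * resolvent l b (n - (j + 1)) := by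
      rw [Finset.mul_sum]
      refine Finset.sum_congr rfl fun j hj => ?_
      have := Finset.mem_range.1 hj
      rw [ih _ (by omega)]
      ring
    have h3 := resolvent_eqn l b n
    rw [one_mul, Finset.sum_range_succ'] at h3
    simp only [arCoeff, Nat.succ_ne_zero, if_false, if_true, zero_mul, add_zero, mul_assoc] at h3
    rw [← Finset.mul_sum] at h3
    rw [h2] at h1
    rcases Nat.eq_zero_or_pos n with rfl | hn
    · simp only [Finset.range_zero, Finset.sum_empty, mul_zero, sub_zero, Nat.cast_zero,
        ← sq] at h1
      rw [resolvent_zero, mul_one, h1]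
      rfl
    · rw [if_neg hn.ne', zero_add] at h3
      have h4 : ∫ ω, innov l a b X n ω * innov l a b X 0 ω ∂μ = 0 :=
        h.integral_innov_mul_past (h.innov_past (by omega))
      rw [h4] at h1
      rw [h3]
      linear_combination -h1

theorem autocov_eqn (h : IsCausalSolution l a b ξ X ρ μ) (n : ℕ) :
    ρ n - ∑' j : ℕ, arCoeff l b j * ρ ((n + j : ℕ) : ℤ) =
      (∫ ω, innov l a b X 0 ω ^ 2 ∂μ) * resolvent l b n := by
  obtain ⟨C, hC⟩ := h.bounded
  have h1 : ∑' j : ℕ, arCoeff l b j * ρ ((n + j : ℕ) : ℤ) =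
      l * ∑' j : ℕ, b (j + 1) * ρ (n + ((j : ℤ) + 1)) := by
    have hs : Summable fun j : ℕ => l * (b (j + 1) * ρ (n + ((j : ℤ) + 1))) := by
      refine Summable.mul_left l (Summable.of_norm_bounded (h.summable.mul_right C) fun j => ?_)
      rw [norm_mul, Real.norm_of_nonneg (h.nonneg _ (by omega))]
      exact mul_le_mul_of_nonneg_left (hC _) (h.nonneg _ (by omega))
    have h2 : ∀ j : ℕ, arCoeff l b (j + 1) * ρ ((n + (j + 1) : ℕ) : ℤ) =
        l * (b (j + 1) * ρ (n + ((j : ℤ) + 1))) := fun j => by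
      rw [arCoeff, if_neg (Nat.succ_ne_zero j), mul_assoc]
      push_cast
      rfl
    rw [← tsum_mul_left, Summable.tsum_eq_zero_add ((summable_nat_add_iff 1).1
      (hs.congr fun j => (h2 j).symm)), tsum_congr h2]
    simp [arCoeff]
  rw [h1, ← h.integral_sol_mul_innov_eq n]
  have h3 := h.integral_innov_mul_sol 0 n
  simp only [sub_zero] at h3
  rw [← h3]
  simp only [mul_comm]

end IsCausalSolution

section

variable {Ω : Type*} [MeasurableSpace Ω] {μ : Measure Ω} [IsProbabilityMeasure μ]
  {l a r : ℝ} {b : ℕ → ℝ} {ξ X : ℤ → Ω → ℝ} {ρ : ℤ → ℝ}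

theorem tsum_enorm_weighted (hb : ∀ j, 1 ≤ j → 0 ≤ b j) (hr0 : 0 < r)
    (hsum : Summable fun j : ℕ => b (j + 1) * (r ^ (j + 1))⁻¹) :
    ∑' j : ℕ, ‖b (j + 1)‖ₑ * ENNReal.ofReal ((r ^ (j + 1))⁻¹) =
      ENNReal.ofReal (∑' j : ℕ, b (j + 1) * (r ^ (j + 1))⁻¹) := by
  have h0 : ∀ j : ℕ, 0 ≤ b (j + 1) := fun j => hb _ (by omega)
  rw [ENNReal.ofReal_tsum_of_nonneg (fun j => mul_nonneg (h0 j) (by positivity)) hsum]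
  refine tsum_congr fun j => ?_
  rw [ENNReal.ofReal_mul (h0 j), Real.enorm_eq_ofReal (h0 j)]

theorem isContractive_of_lt (hb : ∀ j, 1 ≤ j → 0 ≤ b j) (hξ : IsShock ξ μ)
    (hξ2 : MemLp (ξ 0) 2 μ) (hl : l = ∫ ω, ξ 0 ω ∂μ) (hl0 : 0 < l) (hr0 : 0 < r)
    (hsum : Summable fun j : ℕ => b (j + 1) * (r ^ (j + 1))⁻¹)
    (hlt : l * ∑' j : ℕ, b (j + 1) * (r ^ (j + 1))⁻¹ < 1) : IsContractive b ξ r μ := by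
  have h1 : ∫⁻ ω, ‖ξ 0 ω‖ₑ ∂μ = ENNReal.ofReal l := by
    rw [← ofReal_integral_norm_eq_lintegral_enorm (hξ2.integrable one_le_two), hl]
    congr 1
    refine integral_congr_ae ?_
    filter_upwards [hξ.nonneg 0] with ω hω
    exact Real.norm_of_nonneg hω
  rw [IsContractive, h1, tsum_enorm_weighted hb hr0 hsum, ← ENNReal.ofReal_mul hl0.le,
    ENNReal.ofReal_lt_one]
  exact hlt

theorem arCoeff_tsum (l : ℝ) {x : ℝ} (hs : Summable fun j : ℕ => b (j + 1) * x ^ (j + 1)) :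
    HasSum (fun j => arCoeff l b j * x ^ j) (l * ∑' j : ℕ, b (j + 1) * x ^ (j + 1)) := by
  have h1 := hs.hasSum.mul_left l
  have h2 : HasSum (fun j => arCoeff l b (j + 1) * x ^ (j + 1))
      (l * ∑' j : ℕ, b (j + 1) * x ^ (j + 1)) := by
    refine h1.congr_fun fun j => ?_
    rw [arCoeff, if_neg (Nat.succ_ne_zero j), mul_assoc]
  simpa [arCoeff] using (hasSum_nat_add_iff (f := fun j => arCoeff l b j * x ^ j) 1).1 h2

theorem subexp_arCoeff_iff (hl0 : 0 < l) (hr0 : 0 < r) :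
    (Subexp fun n => arCoeff l b n * (r⁻¹) ^ n) ↔ TailMemW r b := by
  rw [tailMemW_iff hr0, ← subexp_shift_weighted_iff hr0 1]
  have h1 : (fun n => arCoeff l b (n + 1) * (r⁻¹) ^ (n + 1)) =
      fun n => (l * r⁻¹) * (b (n + 1) * (r ^ n)⁻¹) := by
    ext n
    rw [arCoeff, if_neg (Nat.succ_ne_zero n), inv_pow, pow_succ, mul_inv]
    ring
  have hc : 0 < l * r⁻¹ := by positivity
  constructor
  · intro h
    have h2 := h.shift 1
    rw [h1] at h2
    convert! h2.const_mul (inv_pos.2 hc) using 2 with n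
    rw [← mul_assoc, inv_mul_cancel₀ hc.ne', one_mul]
  · intro h
    refine Subexp.of_shift (N := 1) ?_
    rw [h1]
    exact h.const_mul hc

end

end ArchInf

theorem theorem4p5 {Ω : Type*} [MeasurableSpace Ω] (μ : Measure Ω) [IsProbabilityMeasure μ]
    (a : ℝ) (b : ℕ → ℝ) (ξ X : ℤ → Ω → ℝ) (ρ : ℤ → ℝ) (l₁ r : ℝ)
    -- standing assumptions on the data
    (ha : 0 < a) (hb : ∀ j, 1 ≤ j → 0 ≤ b j) (hb' : ∃ j, 1 ≤ j ∧ b j ≠ 0)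
    (hξ : ArchInf.IsShock ξ μ) (hξ2 : MemLp (ξ 0) 2 μ)
    (hl : l₁ = ∫ ω, ξ 0 ω ∂μ) (hl0 : 0 < l₁) (hσ : 0 < Var[ξ 0; μ])
    -- the stationary solution and its autocovariance function
    (hX : ArchInf.IsArchSolution a b ξ X μ) (hρ : ArchInf.IsWeaklyStationary X ρ μ)
    -- the assumptions of the theorem
    (hr0 : 0 < r) (hr1 : r < 1)
    (hS2 : ArchInf.CondS2 b ξ μ)
    (hsum : Summable (fun j : ℕ => b (j + 1) * (r ^ (j + 1))⁻¹))
    (hhalf : l₁ * ∑' j : ℕ, b (j + 1) * (r ^ (j + 1))⁻¹ < 1 / 2) :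
    (ArchInf.TailMemW r b ↔ ArchInf.MemW r (fun n : ℕ => ρ n)) ∧
    ((∀ j, 1 ≤ j → 0 < b j) →
      (ArchInf.MemW r (fun n : ℕ => b (n + 1)) ↔ ArchInf.MemW r (fun n : ℕ => ρ n))) ∧
    ((ArchInf.TailMemW r b ∨ ArchInf.MemW r (fun n : ℕ => ρ n)) →
      Integrable (fun ω => ArchInf.innov l₁ a b X 0 ω ^ 2) μ ∧
      Tendsto (fun n : ℕ => ρ n / b n) atTop
        (𝓝 ((∫ ω, ArchInf.innov l₁ a b X 0 ω ^ 2 ∂μ) /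
              (1 - l₁ * ∑' j : ℕ, b (j + 1) * r ^ (j + 1)) *
            (l₁ / (1 - l₁ * ∑' j : ℕ, b (j + 1) * (r ^ (j + 1))⁻¹) ^ 2)))) := by
  have hb0 : ∀ j : ℕ, 0 ≤ b (j + 1) := fun j => hb _ (by omega)
  have hle : ∀ x : ℝ, 0 ≤ x → x ≤ 1 → ∀ j : ℕ,
      b (j + 1) * x ^ (j + 1) ≤ b (j + 1) * (r ^ (j + 1))⁻¹ := fun x hx0 hx1 j =>
    mul_le_mul_of_nonneg_left ((pow_le_one₀ hx0 hx1).trans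
      ((one_le_inv₀ (by positivity)).2 (pow_le_one₀ hr0.le hr1.le))) (hb0 j)
  have hsx : ∀ x : ℝ, 0 ≤ x → x ≤ 1 → Summable fun j : ℕ => b (j + 1) * x ^ (j + 1) :=
    fun x hx0 hx1 => hsum.of_nonneg_of_le
      (fun j => mul_nonneg (hb0 j) (pow_nonneg hx0 _)) (hle x hx0 hx1)
  have hs1 : Summable fun j : ℕ => b (j + 1) := by simpa using hsx 1 zero_le_one le_rfl
  have hcausal : ArchInf.IsCausalSolution l₁ a b ξ X ρ μ := by
    refine ⟨ha, hb, hs1, hξ, hξ2, hl, hl0, ?_, hσ, hX, hρ, fun k => ?_⟩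
    · have h1 : ∑' j : ℕ, b (j + 1) ≤ ∑' j : ℕ, b (j + 1) * (r ^ (j + 1))⁻¹ :=
        hs1.tsum_le_tsum (fun j => by simpa using hle 1 zero_le_one le_rfl j) hsum
      have h2 := mul_le_mul_of_nonneg_left h1 hl0.le
      linarith
    · refine hX.aestronglyMeasurable_past hξ hr0 hr1 ?_
        (ArchInf.isContractive_of_lt hb hξ hξ2 hl hl0 hr0 hsum (by linarith))
        ENNReal.ofReal_ne_top hρ.lintegral_enorm_le k
      rw [ArchInf.tsum_enorm_weighted hb hr0 hsum]
      exact ENNReal.ofReal_ne_top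
  have hsum' : Summable fun j : ℕ => b (j + 1) * (r⁻¹) ^ (j + 1) := by
    simpa only [inv_pow] using hsum
  have hθ := ArchInf.arCoeff_tsum l₁ hsum'
  have hβ := ArchInf.arCoeff_tsum l₁ (hsx r hr0.le hr1.le)
  have hinv : ∑' j : ℕ, b (j + 1) * (r⁻¹) ^ (j + 1) = ∑' j : ℕ, b (j + 1) * (r ^ (j + 1))⁻¹ := by
    simp only [inv_pow]
  have hcov : ArchInf.IsArAutocov l₁ r (∫ ω, ArchInf.innov l₁ a b X 0 ω ^ 2 ∂μ) b
      (fun n : ℕ => ρ n) := by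
    obtain ⟨C, hC⟩ := hcausal.bounded
    refine ⟨hr0, hr1, hcausal.integral_innov_sq_pos, fun n => ?_, hθ.summable, ?_,
      ⟨C, fun n => hC n⟩, hcausal.autocov_eqn⟩
    · rw [ArchInf.arCoeff]
      split_ifs with hn
      · exact le_rfl
      · exact mul_nonneg hl0.le (hb n (by omega))
    · rwa [hθ.tsum_eq, hinv]
  have hiff := ArchInf.subexp_arCoeff_iff (b := b) hl0 hr0
  have hρiff : ArchInf.MemW r (fun n : ℕ => ρ n) ↔
      (∀ n : ℕ, 0 < ρ n) ∧ ArchInf.Subexp fun n : ℕ => ρ n * (r⁻¹) ^ n := by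
    simpa only [inv_pow] using ArchInf.memW_iff (γ := fun n : ℕ => ρ n) hr0
  have hmain : ArchInf.TailMemW r b ↔ ArchInf.MemW r (fun n : ℕ => ρ n) := by
    rw [← hiff, hρiff]
    exact ⟨fun h => ⟨hcov.autocov_pos h, hcov.subexp_autocov h⟩,
      fun h => hcov.subexp_arCoeff h.2⟩
  refine ⟨hmain, fun hpos => ?_, fun h => ⟨(hcausal.innov_memLp 0).integrable_sq, ?_⟩⟩
  · rw [← hmain, ArchInf.memW_tail_iff hr0 1, ArchInf.tailMemW_iff hr0]
    exact and_iff_right hpos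
  · have hT : ArchInf.TailMemW r b := h.elim id hmain.2
    have h1 := (hcov.tendsto_div_arCoeff (hiff.2 hT)).mul_const l₁
    rw [hθ.tsum_eq, hβ.tsum_eq, hinv] at h1
    convert! h1.congr' ?_ using 2
    · ring
    · filter_upwards [eventually_ge_atTop 1] with n hn
      rw [ArchInf.arCoeff, if_neg (by omega), div_mul_eq_mul_div, mul_comm l₁,
        mul_div_mul_right _ _ hl0.ne']
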